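/- A graph is a finite set $V$ of vertices and a finite set $E=E_1\sqcup E_2\sqcup L$ of edges with an incidence map $\iota$: each ordinary edge $e\in E_2$ has $\iota(e)=\{u,v\}$ with $u\neq v$, and each semi-edge $e\in E_1$ and each loop $e\in L$ has $\iota(e)\in V$ (multiple edges of every type are allowed). Write $p_{E_1}(u)$ and $p_{L}(u)$ for the numbers of semi-edges and of loops at the vertex $u$. A graph is bipartite if it has no loops and its vertices can be 2-coloured so that the end-vertices of every ordinary edge get different colours; semi-edges are allowed. A covering projection of $G$ to $H$ is a pair of maps $f_V:V(G)\to V(H)$, $f_E:E(G)\to E(H)$ which commutes with the incidence maps, maps loops to loops and semi-edges to semi-edges, and is locally bijective: for every vertex $u$ of $G$ and every edge $d$ of $H$ incident with $f_V(u)$, the edges of $G$ that are incident with $u$ and mapped to $d$ are exactly one ordinary edge if $d$ is an ordinary edge; either exactly one semi-edge or exactly one ordinary edge (and not both) if $d$ is a semi-edge; either exactly one loop or exactly two ordinary edges (and not both) if $d$ is a loop. A map $f_V:V(G)\to V(H)$ is degree-obedient if for every $x\in V(G)$, with $u=f_V(x)$: (1) for every vertex $v\neq u$ of $H$, the number of ordinary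 edges of $H$ joining $u$ and $v$ equals the number of ordinary edges of $G$ joining $x$ to a vertex of $f_V^{-1}(v)$; (2) $p_{E_1(H)}(u)+2p_{L(H)}(u)=p_{E_1(G)}(x)+2p_{L(G)}(x)+r$, where $r$ is the number of ordinary edges of $G$ joining $x$ to a vertex of $f_V^{-1}(u)\setminus\{x\}$; (3) $p_{E_1(G)}(x)\le p_{E_1(H)}(u)$. Theorem. (a) There is a polynomial-time algorithm which, given a bipartite graph $G$, a graph $H$ and a degree-obedient map $f_V:V(G)\to V(H)$, decides whether there is an $f_E:E(G)\to E(H)$ such that $(f_V,f_E)$ is a covering projection of $G$ to $H$. (b) If $G$ is bipartite and has no semi-edges, then for every graph $H$ and every degree-obedient map $f_V:V(G)\to V(H)$ such an $f_E$ exists. -/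

import Mathlib

/-! ### Graphs with multiple edges, loops and semi-edges -/

/-- The three kinds of edges. -/
inductive EdgeKind : Type
  | semi
  | ordinary
  | loop

/-- A graph with vertex set `V` and edge set `E`. The set `E` is the disjoint union of the
semi-edges, the ordinary edges and the loops, and every edge has its incidence: an unordered pair
of two distinct vertices for an ordinary edge, and a single vertex `v`, written `s(v, v)`, for
a semi-edge or a loop. -/
structure SGraph (V E : Type*) where
  kind : E → EdgeKind
  ends : E → Sym2 V
  isDiag_iff : ∀ e, (ends e).IsDiag ↔ kind e ≠ EdgeKind.ordinary

namespace SGraph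

variable {V E W F : Type*}

/-- The number of semi-edges incident with `u`. -/
noncomputable def numSemi (G : SGraph V E) (u : V) : ℕ :=
  {e : E | G.kind e = EdgeKind.semi ∧ u ∈ G.ends e}.ncard

/-- The number of loops incident with `u`. -/
noncomputable def numLoop (G : SGraph V E) (u : V) : ℕ :=
  {e : E | G.kind e = EdgeKind.loop ∧ u ∈ G.ends e}.ncard

/-- The number of ordinary edges with one end-vertex `x` and the other one in `S \ {x}`. -/
noncomputable def numOrdinaryTo (G : SGraph V E) (x : V) (S : Set V) : ℕ :=
  {e : E | G.kind e = EdgeKind.ordinary ∧ ∃ y ∈ S, y ≠ x ∧ G.ends e = s(x, y)}.ncard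

/-- `G` has no semi-edges. -/
def NoSemiEdges (G : SGraph V E) : Prop :=
  ∀ e, G.kind e ≠ EdgeKind.semi

/-- `G` is bipartite: its vertices have a 2-colouring in which the end-vertices of every ordinary
edge get different colours, and there are no loops. Semi-edges are allowed. -/
def IsBipartite (G : SGraph V E) : Prop :=
  (∀ e, G.kind e ≠ EdgeKind.loop) ∧
    ∃ c : V → Bool, ∀ e, G.kind e = EdgeKind.ordinary →
      ∀ u v, G.ends e = s(u, v) → c u ≠ c v

/-- Degree-obedient vertex mappings. -/
structure IsDegreeObedient (G : SGraph V E) (H : SGraph W F) (fV : V → W) : Prop where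
  ordinary : ∀ u v : W, u ≠ v → ∀ x : V, fV x = u →
    H.numOrdinaryTo u {v} = G.numOrdinaryTo x (fV ⁻¹' {v})
  within : ∀ (u : W) (x : V), fV x = u →
    H.numSemi u + 2 * H.numLoop u =
      G.numSemi x + 2 * G.numLoop x + G.numOrdinaryTo x (fV ⁻¹' {u})
  semi_le : ∀ (u : W) (x : V), fV x = u → G.numSemi x ≤ H.numSemi u

/-- The number of edges of `G` of kind `k` which are incident with `u` and are mapped to `d`. -/
noncomputable def numOver (G : SGraph V E) (fE : E → F) (k : EdgeKind) (u : V) (d : F) : ℕ :=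
  {e : E | G.kind e = k ∧ u ∈ G.ends e ∧ fE e = d}.ncard

/-- `(fV, fE)` is a covering projection of `G` to `H`: loops are mapped to loops, semi-edges to
semi-edges, the pair commutes with the incidence mappings, and it is locally bijective, that is,
* the preimage of a loop at `w` consists of loops and of cycles of ordinary edges (of length at
  least two) which are disjoint and together span the vertices mapped to `w`,
* the preimage of a semi-edge at `w` consists of semi-edges and ordinary edges which are disjoint
  and together span the vertices mapped to `w`,
* the preimage of an ordinary edge is a matching of ordinary edges spanning all vertices that are
  mapped to one of its ends. -/
structure IsCovering (G : SGraph V E) (H : SGraph W F) (fV : V → W) (fE : E → F) : Prop where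
  map_loop : ∀ e, G.kind e = EdgeKind.loop → H.kind (fE e) = EdgeKind.loop
  map_semi : ∀ e, G.kind e = EdgeKind.semi → H.kind (fE e) = EdgeKind.semi
  ends_map : ∀ e, H.ends (fE e) = (G.ends e).map fV
  over_loop : ∀ d, H.kind d = EdgeKind.loop → ∀ u, fV u ∈ H.ends d →
    (G.numOver fE EdgeKind.loop u d = 1 ∧ G.numOver fE EdgeKind.ordinary u d = 0) ∨
    (G.numOver fE EdgeKind.loop u d = 0 ∧ G.numOver fE EdgeKind.ordinary u d = 2)
  over_semi : ∀ d, H.kind d = EdgeKind.semi → ∀ u, fV u ∈ H.ends d →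
    (G.numOver fE EdgeKind.semi u d = 1 ∧ G.numOver fE EdgeKind.ordinary u d = 0) ∨
    (G.numOver fE EdgeKind.semi u d = 0 ∧ G.numOver fE EdgeKind.ordinary u d = 1)
  over_ordinary : ∀ d, H.kind d = EdgeKind.ordinary → ∀ u, fV u ∈ H.ends d →
    G.numOver fE EdgeKind.ordinary u d = 1

/-- The vertex mapping `fV` extends to a covering projection of `G` to `H`. -/
def ExtendsToCovering (G : SGraph V E) (H : SGraph W F) (fV : V → W) : Prop :=
  ∃ fE : E → F, IsCovering G H fV fE

end SGraph

/-! ### Polynomial time on a random access machine -/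

namespace RAM

/-- The store of a random access machine: registers, and memory banks with unboundedly many cells;
all of them hold natural numbers. -/
structure Store where
  reg : ℕ → ℕ
  mem : ℕ → ℕ → ℕ

/-- `x := c` for the register `x`. -/
def Store.setReg (s : Store) (x c : ℕ) : Store :=
  { s with reg := Function.update s.reg x c }

/-- Write `c` into the cell number `i` of the memory bank `a`. -/
def Store.setMem (s : Store) (a i c : ℕ) : Store :=
  { s with mem := Function.update s.mem a (Function.update (s.mem a) i c) }

/-- Programs. The names of registers and of memory banks are fixed in the program text, so a program
uses finitely many of them; the cells of a bank are addressed indirectly, through a register.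
There is no multiplication: a step makes the longest number at most one bit longer, and so
unit cost is polynomially equivalent to the number of steps of a Turing machine. -/
inductive Program : Type
  /-- do nothing -/
  | skip : Program
  /-- `x := c` -/
  | const (x c : ℕ) : Program
  /-- `x := y + z` -/
  | add (x y z : ℕ) : Program
  /-- `x := y - z`, and `0` if `y < z` -/
  | sub (x y z : ℕ) : Program
  /-- `x := a[y]` -/
  | load (x a y : ℕ) : Program
  /-- `a[y] := x` -/
  | store (a y x : ℕ) : Program
  /-- first `p`, then `q` -/
  | seq (p q : Program) : Program
  /-- if `x ≠ 0` then `p` else `q` -/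
  | ite (x : ℕ) (p q : Program) : Program
  /-- while `x ≠ 0` do `p` -/
  | loop (x : ℕ) (p : Program) : Program

/-- `Exec p s s' t`: started in the store `s`, the program `p` halts in the store `s'` after exactly
`t` steps. Every elementary instruction and every test is one step. -/
inductive Exec : Program → Store → Store → ℕ → Prop
  | skip (s : Store) : Exec .skip s s 1
  | const (s : Store) (x c : ℕ) : Exec (.const x c) s (s.setReg x c) 1
  | add (s : Store) (x y z : ℕ) : Exec (.add x y z) s (s.setReg x (s.reg y + s.reg z)) 1
  | sub (s : Store) (x y z : ℕ) : Exec (.sub x y z) s (s.setReg x (s.reg y - s.reg z)) 1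
  | load (s : Store) (x a y : ℕ) : Exec (.load x a y) s (s.setReg x (s.mem a (s.reg y))) 1
  | store (s : Store) (a y x : ℕ) : Exec (.store a y x) s (s.setMem a (s.reg y) (s.reg x)) 1
  | seq {p q : Program} {s s₁ s₂ : Store} {t₁ t₂ : ℕ} :
      Exec p s s₁ t₁ → Exec q s₁ s₂ t₂ → Exec (.seq p q) s s₂ (t₁ + t₂)
  | ite_true {x : ℕ} {p q : Program} {s s₁ : Store} {t : ℕ} :
      s.reg x ≠ 0 → Exec p s s₁ t → Exec (.ite x p q) s s₁ (t + 1)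
  | ite_false {x : ℕ} {p q : Program} {s s₁ : Store} {t : ℕ} :
      s.reg x = 0 → Exec q s s₁ t → Exec (.ite x p q) s s₁ (t + 1)
  | loop_done {x : ℕ} {p : Program} {s : Store} :
      s.reg x = 0 → Exec (.loop x p) s s 1
  | loop_again {x : ℕ} {p : Program} {s s₁ s₂ : Store} {t₁ t₂ : ℕ} :
      s.reg x ≠ 0 → Exec p s s₁ t₁ → Exec (.loop x p) s₁ s₂ t₂ →
        Exec (.loop x p) s s₂ (t₁ + t₂ + 1)

/-- The initial store for an input that consists of finitely many lists of numbers: the bank `i`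
holds the list number `i`, the register `i` holds its length, and everything else is `0`. -/
def initStore (w : List (List ℕ)) : Store where
  reg i := (w.getD i []).length
  mem i j := (w.getD i []).getD j 0

/-- The length of an input: the total number of bits of its numbers, plus one for each number. -/
def inputSize (w : List (List ℕ)) : ℕ :=
  (w.flatten.map fun x => x.size + 1).sum

/-- A decision problem, given on those inputs that satisfy `promise`, is decidable in polynomial
time: there are one program and one polynomial such that on every such input the program
halts, within the polynomial of the input length, with a nonzero number in register `0` if the
answer is yes and with `0` there if it is no. -/
def DecidableInPolyTime {α : Type*} (encode : α → List (List ℕ)) (promise yes : α → Prop) : Prop :=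
  ∃ (p : Program) (q : Polynomial ℕ), ∀ a, promise a →
    ∃ (s : Store) (t : ℕ), Exec p (initStore (encode a)) s t ∧
      t ≤ q.eval (inputSize (encode a)) ∧ (s.reg 0 ≠ 0 ↔ yes a)

end RAM

/-! ### The extension problem as a decision problem -/

/-- The number that stands for an edge kind. -/
def EdgeKind.code : EdgeKind → ℕ
  | .semi => 0
  | .ordinary => 1
  | .loop => 2

/-- A finite graph with vertices `0, …, n - 1` and edges `0, …, m - 1` is given by the list of its
vertices, the list of the kinds of its edges, and the lists of the smaller and of the larger
end-vertices of its edges. -/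
def SGraph.encode {n m : ℕ} (G : SGraph (Fin n) (Fin m)) : List (List ℕ) :=
  [List.range n,
   List.ofFn fun e => (G.kind e).code,
   List.ofFn fun e => ((G.ends e).inf : ℕ),
   List.ofFn fun e => ((G.ends e).sup : ℕ)]

/-- An instance: two finite graphs and a mapping between their vertex sets. -/
structure ExtensionInstance where
  {n m n' m' : ℕ}
  G : SGraph (Fin n) (Fin m)
  H : SGraph (Fin n') (Fin m')
  fV : Fin n → Fin n'

/-- The input for an instance: both graphs, and the table of the vertex mapping. -/
def ExtensionInstance.encode (I : ExtensionInstance) : List (List ℕ) :=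
  I.G.encode ++ I.H.encode ++ [List.ofFn fun u => (I.fV u : ℕ)]

/-! Everything reduces to one degree-constrained subgraph problem. A covering projection singles out
the ordinary edges of `G` that lie over loops of `H`; they stay inside fibres, and a vertex `x`
meets exactly two of them for every loop at `fV x`. Such an edge set is a loop factor
(`HasLoopFactor`), and for bipartite `G` and degree-obedient `fV` it is also sufficient. Remove it:
over each vertex pair of `H`, and separately inside the factor over each vertex, the remaining task
is to colour a regular edge set so that every vertex sees each colour once, where a loop contributes
two colours. `IsBipartite.exists_colouring` does this by König's theorem, applied to a double cover
in which semi-edges become ordinary edges.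

Loop factors need only be found approximately. By `exists_factor_of_fractional`, a consequence of
Hall's theorem, a fractional edge selection whose degree errors sum to less than 1 can be rounded to
an exact factor. If `G` has no semi-edges, a weight constant on each fibre is an exact fractional
factor, which gives (b).

For (a), a local search replaces network flow. Take integer weights between 0 and `K = n * m + 1`,
and let the energy be the sum over the vertices of the squared deviation from `K` times the required
degree. Change single weights by 1 as long as the energy drops. It starts polynomially bounded and
is a natural number, so polynomially many sweeps suffice. At a local minimum, comparison with `K`
times the indicator of a loop factor, if there is one, bounds the energy by `m * K`
(`HasLoopFactor.energy_le`), and Cauchy–Schwarz makes the total deviation smaller than `K`.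
Conversely, a total deviation below `K` becomes, after division by `K`, a total error below 1, and
rounding produces a loop factor. So the final test `total deviation < K` decides the problem. -/

/-! ### Rounding fractional factors of bipartite multigraphs -/

theorem card_filter_sdiff_of_subset {E : Type*} [DecidableEq E] {S T : Finset E}
    (hTS : T ⊆ S) (p : E → Prop) [DecidablePred p] :
    (S.filter p).card = ((S \ T).filter p).card + (T.filter p).card := by
  rw [← Finset.card_union_of_disjoint
    (Finset.disjoint_filter_filter Finset.sdiff_disjoint), ← Finset.filter_union,
    Finset.sdiff_union_of_subset hTS]

/-- In a bipartite multigraph, given by the two ends `src e`, `tgt e` of its edges, a fractional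
selection of edges whose degrees differ from `b` and `b'` by less than `1` in total can be replaced
by a set of edges with exactly these degrees. -/
theorem exists_factor_of_fractional {A B E : Type*} [Fintype A] [Fintype B]
    [DecidableEq A] [DecidableEq B] (src : E → A) (tgt : E → B) (S : Finset E)
    (b : A → ℕ) (b' : B → ℕ) (y : E → ℚ) (y_nonneg : ∀ e ∈ S, 0 ≤ y e) (y_le : ∀ e ∈ S, y e ≤ 1)
    (b_le : ∀ a, b a ≤ (S.filter (src · = a)).card)
    (err : ∑ a, |∑ e ∈ S with src e = a, y e - b a| +
      ∑ a, |∑ e ∈ S with tgt e = a, y e - b' a| < 1) :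
    ∃ T ⊆ S, (∀ a, (T.filter (src · = a)).card = b a) ∧
      ∀ a, (T.filter (tgt · = a)).card = b' a := by
  classical
  -- An edge is either rejected, and then charged to its source, or selected, and then charged to
  -- its target. So a source needs as many slots as edges to reject, and a target as many as edges
  -- to select.
  set d : A ⊕ B → ℕ := Sum.elim (fun a => (S.filter (src · = a)).card - b a) b' with hd
  have sum_src : ∀ (R : Finset E) (f : E → ℚ), ∑ a, ∑ e ∈ R with src e = a, f e = ∑ e ∈ R, f e :=
    fun R f => Finset.sum_fiberwise R src f
  have sum_tgt : ∀ (R : Finset E) (f : E → ℚ), ∑ a, ∑ e ∈ R with tgt e = a, f e = ∑ e ∈ R, f e :=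
    fun R f => Finset.sum_fiberwise R tgt f
  -- The two totals are integers, and both are compared with the same total of `y`, so an error
  -- below 1 forces equality.
  have hsum : (∑ a, b a : ℕ) = ∑ a, b' a := by
    have h1 : |(∑ a, (b a : ℚ)) - ∑ a, (b' a : ℚ)| < 1 := by
      have e1 : (∑ a, (b a : ℚ)) - ∑ a, (b' a : ℚ) =
          ∑ a, (∑ e ∈ S with tgt e = a, y e - b' a) - ∑ a, (∑ e ∈ S with src e = a, y e - b a) := by
        rw [Finset.sum_sub_distrib, Finset.sum_sub_distrib, sum_src, sum_tgt]; ring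
      rw [e1]
      refine (abs_sub _ _).trans_lt (lt_of_le_of_lt ?_ err)
      rw [add_comm]
      exact add_le_add (Finset.abs_sum_le_sum_abs _ _) (Finset.abs_sum_le_sum_abs _ _)
    have h2 : |((∑ a, b a : ℕ) : ℤ) - (∑ a, b' a : ℕ)| < 1 := by
      have : ((|((∑ a, b a : ℕ) : ℤ) - (∑ a, b' a : ℕ)| : ℤ) : ℚ) < (1 : ℤ) := by
        push_cast; exact h1
      exact_mod_cast this
    have := Int.abs_lt_one_iff.1 h2
    omega
  have hcard : S.card = ∑ v, d v := by
    have : S.card = ∑ a, (S.filter (src · = a)).card :=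
      Finset.card_eq_sum_card_fiberwise (fun _ _ => Finset.mem_univ _)
    simp only [hd, Fintype.sum_sum_type, Sum.elim_inl, Sum.elim_inr, ← hsum,
      ← Finset.sum_add_distrib]
    rw [this]
    exact Finset.sum_congr rfl fun a _ => (Nat.sub_add_cancel (b_le a)).symm
  -- Hall's theorem will assign distinct slots to the edges, each at its own source or its own
  -- target.
  let slots : S → Finset (Σ v, Fin (d v)) := fun e =>
    Finset.univ.filter fun p => p.1 = Sum.inl (src e) ∨ p.1 = Sum.inr (tgt e)
  have hall : ∀ R : Finset S, R.card ≤ (R.biUnion slots).card := by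
    intro R
    set R' : Finset E := R.map ⟨Subtype.val, Subtype.val_injective⟩ with hR'
    have hR'S : R' ⊆ S := by
      intro e he
      simp only [hR', Finset.mem_map, Function.Embedding.coeFn_mk] at he
      obtain ⟨x, -, rfl⟩ := he
      exact x.2
    have hR'card : R'.card = R.card := Finset.card_map _
    set X := R'.image src
    set Y := R'.image tgt
    have hN : (R.biUnion slots).card = ∑ a ∈ X, d (Sum.inl a) + ∑ a ∈ Y, d (Sum.inr a) := by
      have : R.biUnion slots = (X.disjSum Y).sigma fun v => (Finset.univ : Finset (Fin (d v))) := by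
        ext ⟨v, i⟩
        rcases v with v | v <;>
          simp [slots, X, Y, hR', and_comm, eq_comm]
      rw [this, Finset.card_sigma, Finset.sum_disjSum]
      simp
    -- Every edge of `R'` counts as `1 - y e` at its source plus `y e` at its target. Enlarging to
    -- all edges of `S` at `X` and at `Y` gives the number of available slots up to an error below
    -- 1, so integrality yields Hall's condition.
    have hlt : (R'.card : ℚ) < (∑ a ∈ X, d (Sum.inl a) + ∑ a ∈ Y, d (Sum.inr a) : ℕ) + 1 := by
      have e1 : (R'.card : ℚ) = ∑ e ∈ R', (1 - y e) + ∑ e ∈ R', y e := by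
        rw [← Finset.sum_add_distrib]; simp
      have e2 : ∑ e ∈ R', (1 - y e) ≤ ∑ a ∈ X, ∑ e ∈ S with src e = a, (1 - y e) := by
        rw [← Finset.sum_fiberwise_of_maps_to (g := src) (t := X)
          (fun e he => Finset.mem_image_of_mem _ he)]
        refine Finset.sum_le_sum fun a _ => Finset.sum_le_sum_of_subset_of_nonneg
          (Finset.filter_subset_filter _ hR'S) fun e he _ => ?_
        have := y_le e (Finset.mem_filter.1 he).1
        linarith
      have e3 : ∑ e ∈ R', y e ≤ ∑ a ∈ Y, ∑ e ∈ S with tgt e = a, y e := by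
        rw [← Finset.sum_fiberwise_of_maps_to (g := tgt) (t := Y)
          (fun e he => Finset.mem_image_of_mem _ he)]
        exact Finset.sum_le_sum fun a _ => Finset.sum_le_sum_of_subset_of_nonneg
          (Finset.filter_subset_filter _ hR'S) fun e he _ => y_nonneg e (Finset.mem_filter.1 he).1
      have e4 : ∑ a ∈ X, ∑ e ∈ S with src e = a, (1 - y e) ≤
          ∑ a ∈ X, (d (Sum.inl a) : ℚ) + ∑ a, |∑ e ∈ S with src e = a, y e - b a| := by
        refine le_trans ?_ (add_le_add_right (Finset.sum_le_sum_of_subset_of_nonneg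
          (Finset.subset_univ X) fun _ _ _ => abs_nonneg _) _)
        rw [← Finset.sum_add_distrib]
        refine Finset.sum_le_sum fun a _ => ?_
        have := neg_abs_le (∑ e ∈ S with src e = a, y e - b a)
        simp only [hd, Sum.elim_inl, Nat.cast_sub (b_le a), Finset.sum_sub_distrib,
          Finset.sum_const, nsmul_eq_mul, mul_one]
        linarith
      have e5 : ∑ a ∈ Y, ∑ e ∈ S with tgt e = a, y e ≤
          ∑ a ∈ Y, (d (Sum.inr a) : ℚ) + ∑ a, |∑ e ∈ S with tgt e = a, y e - b' a| := by
        refine le_trans ?_ (add_le_add_right (Finset.sum_le_sum_of_subset_of_nonneg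
          (Finset.subset_univ Y) fun _ _ _ => abs_nonneg _) _)
        rw [← Finset.sum_add_distrib]
        refine Finset.sum_le_sum fun a _ => ?_
        have := le_abs_self (∑ e ∈ S with tgt e = a, y e - b' a)
        simp only [hd, Sum.elim_inr]
        linarith
      push_cast
      linarith
    rw [hN, ← hR'card]
    have : R'.card < (∑ a ∈ X, d (Sum.inl a) + ∑ a ∈ Y, d (Sum.inr a)) + 1 := by exact_mod_cast hlt
    omega
  obtain ⟨f, f_inj, hf⟩ := (Finset.all_card_le_biUnion_card_iff_exists_injective slots).1 hall
  -- There are exactly as many slots as edges, so every slot is used and the degrees come out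
  -- exactly.
  have f_bij : Function.Bijective f := by
    refine (Fintype.bijective_iff_injective_and_card f).2 ⟨f_inj, ?_⟩
    simp [hcard]
  have count : ∀ v, (Finset.univ.filter fun e : S => (f e).1 = v).card = d v := by
    intro v
    have h1 : (Finset.univ.filter fun p : Σ v, Fin (d v) => p.1 = v).card = d v := by
      have : (Finset.univ.filter fun p : Σ v, Fin (d v) => p.1 = v) =
          ({v} : Finset (A ⊕ B)).sigma fun v => (Finset.univ : Finset (Fin (d v))) := by
        ext ⟨w, i⟩; simp
      rw [this, Finset.card_sigma]; simp
    rw [← h1]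
    refine Finset.card_bij (fun e _ => f e) (by simp) (fun _ _ _ _ h => f_inj h) ?_
    intro p hp
    obtain ⟨e, rfl⟩ := f_bij.2 p
    exact ⟨e, by simpa using hp, rfl⟩
  have mem_slots : ∀ e : S, (f e).1 = Sum.inl (src e) ∨ (f e).1 = Sum.inr (tgt e) := fun e => by
    simpa [slots] using hf e
  let T : Finset E := (Finset.univ.filter fun e : S => (f e).1 = Sum.inr (tgt e)).map
    ⟨Subtype.val, Subtype.val_injective⟩
  have mem_T : ∀ e : S, (e : E) ∈ T ↔ (f e).1 = Sum.inr (tgt e) := fun e => by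
    simp [T]
  have hTS : T ⊆ S := by
    intro e he
    simp only [T, Finset.mem_map, Function.Embedding.coeFn_mk] at he
    obtain ⟨x, -, rfl⟩ := he
    exact x.2
  refine ⟨T, hTS, fun a => ?_, fun a => ?_⟩
  · have h1 : ((S \ T).filter (src · = a)).card = d (Sum.inl a) := by
      rw [← count]
      symm
      refine Finset.card_bij (fun e _ => (e : E)) ?_ (fun _ _ _ _ h => Subtype.val_injective h) ?_
      · intro e he
        simp only [Finset.mem_filter, Finset.mem_univ, true_and] at he
        simp only [Finset.mem_filter, Finset.mem_sdiff, e.2, true_and, mem_T, he]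
        refine ⟨by simp, ?_⟩
        rcases mem_slots e with h | h <;> simp_all
      · intro e he
        simp only [Finset.mem_filter, Finset.mem_sdiff] at he
        refine ⟨⟨e, he.1.1⟩, ?_, rfl⟩
        have := mem_T ⟨e, he.1.1⟩
        rcases mem_slots ⟨e, he.1.1⟩ with h | h <;> simp_all
    have h2 := card_filter_sdiff_of_subset hTS (src · = a)
    have h3 := b_le a
    simp only [hd, Sum.elim_inl] at h1
    omega
  · have h1 := count (Sum.inr a)
    simp only [hd, Sum.elim_inr] at h1
    rw [← h1]
    symm
    refine Finset.card_bij (fun e _ => (e : E)) ?_ (fun _ _ _ _ h => Subtype.val_injective h) ?_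
    · intro e he
      simp only [Finset.mem_filter, Finset.mem_univ, true_and] at he
      simp only [Finset.mem_filter, mem_T, he]
      rcases mem_slots e with h | h <;> simp_all
    · intro e he
      simp only [Finset.mem_filter] at he
      refine ⟨⟨e, hTS he.1⟩, ?_, rfl⟩
      have := mem_T ⟨e, hTS he.1⟩
      simp_all

/-! ### König's edge colouring theorem -/

section Matching

variable {C E : Type*} [DecidableEq C] {g : E → C} {k : ℕ} {S T : Finset E}

theorem sum_one_div_degree (hg : ∀ e ∈ S, (S.filter (g · = g e)).card = k + 1) (a : C) :
    ∑ e ∈ S with g e = a, (1 / (k + 1 : ℚ)) = ((if a ∈ S.image g then 1 else 0 : ℕ) : ℚ) := by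
  rw [Finset.sum_const, nsmul_eq_mul]
  split_ifs with h
  · obtain ⟨e, he, rfl⟩ := Finset.mem_image.1 h
    rw [hg e he]
    have : (k + 1 : ℚ) ≠ 0 := by positivity
    push_cast
    field_simp
  · rw [Finset.filter_eq_empty_iff.2 fun {e} he hea => h (Finset.mem_image.2 ⟨e, he, hea⟩)]
    simp

variable [DecidableEq E]

theorem degree_sdiff_matching (hTS : T ⊆ S)
    (hg : ∀ e ∈ S, (S.filter (g · = g e)).card = k + 1)
    (hT : ∀ a, (T.filter (g · = a)).card = if a ∈ S.image g then 1 else 0) :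
    ∀ e ∈ S \ T, ((S \ T).filter (g · = g e)).card = k := by
  intro e he
  have he' := (Finset.mem_sdiff.1 he).1
  have h2 := card_filter_sdiff_of_subset hTS (g · = g e)
  rw [hg e he', hT, if_pos (Finset.mem_image_of_mem g he')] at h2
  omega

/-- The removed matching receives the new colour `k`, which cannot clash with the colours below `k`
on the other edges. -/
theorem proper_extend_matching
    (hT : ∀ a, (T.filter (g · = a)).card = if a ∈ S.image g then 1 else 0) {col : E → ℕ}
    (hc : ∀ e ∈ S \ T, col e < k)
    (hcg : ∀ e ∈ S \ T, ∀ e' ∈ S \ T, g e = g e' → col e = col e' → e = e') :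
    ∀ e ∈ S, ∀ e' ∈ S, g e = g e' →
      (if e ∈ T then k else col e) = (if e' ∈ T then k else col e') → e = e' := by
  intro e he e' he' hee hcol
  by_cases h : e ∈ T <;> by_cases h' : e' ∈ T
  · have : (T.filter (g · = g e')).card ≤ 1 := by
      rw [hT]; split_ifs <;> omega
    exact Finset.card_le_one.1 this e (Finset.mem_filter.2 ⟨h, hee⟩) e'
      (Finset.mem_filter.2 ⟨h', rfl⟩)
  · have := hc e' (Finset.mem_sdiff.2 ⟨he', h'⟩)
    simp only [h, h', if_true, if_false] at hcol
    omega
  · have := hc e (Finset.mem_sdiff.2 ⟨he, h⟩)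
    simp only [h, h', if_true, if_false] at hcol
    omega
  · simp only [h, h', if_false] at hcol
    exact hcg e (Finset.mem_sdiff.2 ⟨he, h⟩) e' (Finset.mem_sdiff.2 ⟨he', h'⟩) hee hcol

end Matching

/-- König: a bipartite multigraph in which every vertex of positive degree has degree `k` is the
disjoint union of `k` matchings. -/
theorem exists_proper_edge_colouring {A B E : Type*} [Finite A] [Finite B]
    [DecidableEq A] [DecidableEq B] (src : E → A) (tgt : E → B) (k : ℕ) (S : Finset E)
    (h_src : ∀ e ∈ S, (S.filter (src · = src e)).card = k)
    (h_tgt : ∀ e ∈ S, (S.filter (tgt · = tgt e)).card = k) :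
    ∃ col : E → ℕ, (∀ e ∈ S, col e < k) ∧
      (∀ e ∈ S, ∀ e' ∈ S, src e = src e' → col e = col e' → e = e') ∧
      ∀ e ∈ S, ∀ e' ∈ S, tgt e = tgt e' → col e = col e' → e = e' := by
  classical
  have := Fintype.ofFinite A
  have := Fintype.ofFinite B
  induction k generalizing S with
  | zero =>
    have hS : S = ∅ := by
      refine Finset.eq_empty_of_forall_notMem fun e he => ?_
      have := Finset.card_eq_zero.1 (h_src e he)
      exact Finset.notMem_empty e (this ▸ Finset.mem_filter.2 ⟨he, rfl⟩)
    subst hS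
    exact ⟨fun _ => 0, by simp, by simp, by simp⟩
  | succ k ih =>
    -- The uniform weight `1 / (k + 1)` gives total weight exactly 1 at every vertex that meets `S`,
    -- so the rounding error is 0 and `T` is a matching covering all these vertices.
    obtain ⟨T, hTS, hT1, hT2⟩ := exists_factor_of_fractional src tgt S
      (fun a => if a ∈ S.image src then 1 else 0) (fun a => if a ∈ S.image tgt then 1 else 0)
      (fun _ => 1 / (k + 1 : ℚ)) (fun _ _ => by positivity)
      (fun _ _ => by
        rw [div_le_one (by positivity)]
        have : (0 : ℚ) ≤ k := by positivity
        linarith)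
      (fun a => by
        split_ifs with h
        · obtain ⟨e, he, rfl⟩ := Finset.mem_image.1 h
          rw [h_src e he]; omega
        · exact Nat.zero_le _)
      (by
        simp only [sum_one_div_degree h_src, sum_one_div_degree h_tgt, sub_self, abs_zero,
          Finset.sum_const_zero, add_zero, zero_lt_one])
    obtain ⟨col, hc, hc1, hc2⟩ := ih (S \ T) (degree_sdiff_matching hTS h_src hT1)
      (degree_sdiff_matching hTS h_tgt hT2)
    refine ⟨fun e => if e ∈ T then k else col e, fun e he => ?_,
      proper_extend_matching hT1 hc hc1, proper_extend_matching hT2 hc hc2⟩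
    dsimp only
    split_ifs with h
    · omega
    · have := hc e (Finset.mem_sdiff.2 ⟨he, h⟩)
      omega

/-! ### Colouring regular edge sets in bipartite graphs with semi-edges -/

namespace SGraph

variable {V E W F : Type*} {G : SGraph V E} {H : SGraph W F} {fV : V → W}

/-- The two ends of every edge, ordered by a proper 2-colouring. -/
theorem IsBipartite.exists_ends (hG : G.IsBipartite) :
    ∃ (c : V → Bool) (t f : E → V), (∀ e, G.ends e = s(t e, f e)) ∧
      (∀ e, G.kind e = EdgeKind.ordinary → c (t e) = true ∧ c (f e) = false) ∧
      ∀ e, G.kind e ≠ EdgeKind.ordinary → t e = f e := by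
  obtain ⟨-, c, hc⟩ := hG
  have : ∀ e, ∃ a b, G.ends e = s(a, b) ∧
      (G.kind e = EdgeKind.ordinary → c a = true ∧ c b = false) := by
    intro e
    obtain ⟨a, b, hab⟩ : ∃ a b, G.ends e = s(a, b) :=
      Sym2.ind (f := fun p => ∃ a b, p = s(a, b)) (fun a b => ⟨a, b, rfl⟩) (G.ends e)
    by_cases hk : G.kind e = EdgeKind.ordinary
    · have := hc e hk a b hab
      cases ha : c a
      · exact ⟨b, a, by rw [hab, Sym2.eq_swap], fun _ => ⟨by simp_all, ha⟩⟩
      · exact ⟨a, b, hab, fun _ => ⟨ha, by simp_all⟩⟩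
    · exact ⟨a, b, hab, fun h => absurd h hk⟩
  choose t f h1 h2 using this
  refine ⟨c, t, f, h1, h2, fun e he => ?_⟩
  have := (G.isDiag_iff e).2 he
  rwa [h1, Sym2.mk_isDiag_iff] at this

theorem kind_ne_ordinary_iff_exists (e : E) :
    G.kind e ≠ EdgeKind.ordinary ↔ ∃ u, G.ends e = s(u, u) := by
  rw [← G.isDiag_iff e]
  induction G.ends e with
  | _ a b =>
    simp only [Sym2.mk_isDiag_iff, Sym2.eq_iff]
    constructor
    · rintro rfl; exact ⟨a, by simp⟩
    · rintro ⟨u, h | h⟩ <;> simp [h.1, h.2]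

theorem ends_eq_of_mem {e : E} (he : G.kind e ≠ EdgeKind.ordinary) {u : V} (hu : u ∈ G.ends e) :
    G.ends e = s(u, u) := by
  obtain ⟨v, hv⟩ := (kind_ne_ordinary_iff_exists e).1 he
  rw [hv] at hu ⊢
  simp only [Sym2.mem_iff, or_self] at hu
  rw [hu]

/-- In a bipartite graph with semi-edges, every regular set of edges can be coloured
such that every vertex is incident with exactly one edge of each colour. -/
theorem IsBipartite.exists_colouring [Finite V] [Finite E] (hG : G.IsBipartite) (S : Set E)
    (X : Set V) (C : Type*) [Finite C] (hX : ∀ e ∈ S, ∀ x ∈ G.ends e, x ∈ X)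
    (h : ∀ x ∈ X, {e | e ∈ S ∧ x ∈ G.ends e}.ncard = Nat.card C) :
    ∃ col : S → C, ∀ x ∈ X, ∀ c, ∃! e : S, x ∈ G.ends e ∧ col e = c := by
  classical
  obtain ⟨c, t, f, h_ends, h_ord, h_diag⟩ := hG.exists_ends
  have := Fintype.ofFinite E
  -- The bipartite double cover on two copies of `V`: an ordinary edge has two lifts, one for each
  -- direction, and a semi-edge at `u` has one lift, joining the two copies of `u`. Degrees are
  -- preserved.
  let S' : Finset (E × Bool) :=
    Finset.univ.filter fun p => p.1 ∈ S ∧ (p.2 = true ∨ G.kind p.1 = EdgeKind.ordinary)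
  have mem_S' : ∀ e b, (e, b) ∈ S' ↔ e ∈ S ∧ (b = true ∨ G.kind e = EdgeKind.ordinary) := by
    simp [S']
  have t_mem : ∀ e, t e ∈ G.ends e := fun e => by simp [h_ends]
  have f_mem : ∀ e, f e ∈ G.ends e := fun e => by simp [h_ends]
  have ne_of_ord : ∀ e, G.kind e = EdgeKind.ordinary → t e ≠ f e := fun e he hne => by
    have := h_ord e he
    rw [hne] at this
    simp_all
  let src : E × Bool → V := fun p => if p.2 then t p.1 else f p.1
  let tgt : E × Bool → V := fun p => if p.2 then f p.1 else t p.1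
  have degree : ∀ g : E × Bool → V,
      (∀ e, (g (e, true) = t e ∧ g (e, false) = f e) ∨ (g (e, true) = f e ∧ g (e, false) = t e)) →
      ∀ x, (S'.filter (g · = x)).card = {e | e ∈ S ∧ x ∈ G.ends e}.ncard := by
    intro g hg x
    have h1 : {e | e ∈ S ∧ x ∈ G.ends e} = ((S'.filter (g · = x)).image Prod.fst : Finset E) := by
      ext e
      simp only [Set.mem_ofPred_eq, Finset.coe_image, Set.mem_image, Finset.mem_coe,
        Finset.mem_filter, Prod.exists, exists_and_right, exists_eq_right, mem_S']
      constructor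
      · rintro ⟨he, hx⟩
        rw [h_ends, Sym2.mem_iff] at hx
        by_cases hk : G.kind e = EdgeKind.ordinary
        · rcases hg e with ⟨h1, h2⟩ | ⟨h1, h2⟩ <;> rcases hx with rfl | rfl
          · exact ⟨true, ⟨he, Or.inl rfl⟩, h1⟩
          · exact ⟨false, ⟨he, Or.inr hk⟩, h2⟩
          · exact ⟨false, ⟨he, Or.inr hk⟩, h2⟩
          · exact ⟨true, ⟨he, Or.inl rfl⟩, h1⟩
        · refine ⟨true, ⟨he, Or.inl rfl⟩, ?_⟩
          rw [h_diag e hk] at hx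
          rcases hg e with ⟨h1, -⟩ | ⟨h1, -⟩ <;> simp_all
      · rintro ⟨b, ⟨he, -⟩, rfl⟩
        refine ⟨he, ?_⟩
        rcases hg e with ⟨h1, h2⟩ | ⟨h1, h2⟩ <;> cases b <;> simp [h1, h2, t_mem, f_mem]
    rw [h1, Set.ncard_coe_finset, Finset.card_image_of_injOn]
    have key : ∀ e, (e, false) ∈ S' → g (e, true) ≠ g (e, false) := fun e he h => by
      have hk : G.kind e = EdgeKind.ordinary := by simpa using ((mem_S' _ _).1 he).2
      rcases hg e with ⟨h1, h2⟩ | ⟨h1, h2⟩ <;> rw [h1, h2] at h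
      · exact ne_of_ord e hk h
      · exact ne_of_ord e hk h.symm
    rintro ⟨e, b⟩ hp ⟨e', b'⟩ hp' hee
    simp only at hee
    subst hee
    simp only [Finset.coe_filter, Set.mem_ofPred_eq] at hp hp'
    have := key e
    cases b <;> cases b' <;> simp_all
  have hsrc := degree src fun e => Or.inl ⟨rfl, rfl⟩
  have htgt := degree tgt fun e => Or.inr ⟨rfl, rfl⟩
  have src_X : ∀ p ∈ S', src p ∈ X := by
    rintro ⟨e, b⟩ hp
    have he := ((mem_S' e b).1 hp).1
    cases b
    · exact hX e he _ (f_mem e)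
    · exact hX e he _ (t_mem e)
  have tgt_X : ∀ p ∈ S', tgt p ∈ X := by
    rintro ⟨e, b⟩ hp
    have he := ((mem_S' e b).1 hp).1
    cases b
    · exact hX e he _ (t_mem e)
    · exact hX e he _ (f_mem e)
  obtain ⟨col, col_lt, col_src, col_tgt⟩ := exists_proper_edge_colouring src tgt (Nat.card C) S'
    (fun p hp => by rw [hsrc, h _ (src_X p hp)]) (fun p hp => by rw [htgt, h _ (tgt_X p hp)])
  have mem_true : ∀ e : S, ((e : E), true) ∈ S' := fun e => (mem_S' _ _).2 ⟨e.2, Or.inl rfl⟩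
  let ev := Finite.equivFin C
  refine ⟨fun e => ev.symm ⟨col (e, true), col_lt _ (mem_true e)⟩, fun x hx => ?_⟩
  -- The colour of `e` is that of its lift `(e, true)` alone. For `x` of colour `true` the lifts of
  -- all edges at `x` share their source, and for colour `false` they share their target, so one
  -- proper colouring serves both sides. Injectivity together with the degree count then gives each
  -- colour exactly once.
  have inj : ∀ e e' : S, x ∈ G.ends e → x ∈ G.ends e' →
      col (e, true) = col (e', true) → e = e' := by
    intro e e' he he' hee
    have side : ∀ e : S, x ∈ G.ends e → (c x = true → t e = x) ∧ (c x = false → f e = x) := by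
      intro e he
      rw [h_ends, Sym2.mem_iff] at he
      by_cases hk : G.kind e = EdgeKind.ordinary
      · have := h_ord e hk
        rcases he with rfl | rfl <;> simp [this]
      · have := h_diag e hk
        rcases he with rfl | rfl <;> simp [this]
    refine Subtype.ext (congrArg Prod.fst (?_ : ((e : E), true) = ((e' : E), true)))
    cases hcx : c x
    · exact col_tgt _ (mem_true e) _ (mem_true e')
        (((side e he).2 hcx).trans ((side e' he').2 hcx).symm) hee
    · exact col_src _ (mem_true e) _ (mem_true e')
        (((side e he).1 hcx).trans ((side e' he').1 hcx).symm) hee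
  let g : {e : E // e ∈ S ∧ x ∈ G.ends e} → Fin (Nat.card C) :=
    fun e => ⟨col (e, true), col_lt _ (mem_true ⟨e, e.2.1⟩)⟩
  have g_bij : Function.Bijective g := by
    have := Fintype.ofFinite {e : E // e ∈ S ∧ x ∈ G.ends e}
    refine (Fintype.bijective_iff_injective_and_card g).2 ⟨fun e e' hee => ?_, ?_⟩
    · have := inj ⟨e, e.2.1⟩ ⟨e', e'.2.1⟩ e.2.2 e'.2.2 (congrArg Fin.val hee)
      exact Subtype.ext (congrArg (fun e : S => (e : E)) this)
    · rw [← Nat.card_eq_fintype_card, Fintype.card_fin, ← h x hx]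
      rfl
  intro i
  obtain ⟨⟨e, heS, hex⟩, he⟩ := g_bij.2 (ev i)
  refine ⟨⟨e, heS⟩, ⟨hex, ?_⟩, ?_⟩
  · rw [Equiv.symm_apply_eq]
    exact he
  · rintro e' ⟨hx', hi⟩
    rw [Equiv.symm_apply_eq, ← he] at hi
    exact inj _ _ hx' hex (congrArg Fin.val hi)

/-! ### Loop factors and covering projections -/

/-- A set of ordinary edges inside the fibres of `fV` in which every vertex is incident with as many
edges as needed to cover the loops at its image. -/
def HasLoopFactor (G : SGraph V E) (H : SGraph W F) (fV : V → W) : Prop :=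
  ∃ T : Set E, (∀ e ∈ T, G.kind e = EdgeKind.ordinary ∧ ((G.ends e).map fV).IsDiag) ∧
    ∀ x, {e | e ∈ T ∧ x ∈ G.ends e}.ncard = 2 * H.numLoop (fV x)

theorem mem_map_ends {e : E} {x : V} (hx : x ∈ G.ends e) : fV x ∈ (G.ends e).map fV :=
  Sym2.mem_map.2 ⟨x, hx, rfl⟩

theorem map_ends_eq_of_mem {e : E} {x : V} (hd : ((G.ends e).map fV).IsDiag)
    (hx : x ∈ G.ends e) : (G.ends e).map fV = s(fV x, fV x) := by
  have := mem_map_ends (fV := fV) hx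
  revert hd this
  induction (G.ends e).map fV with
  | _ a b =>
    intro hd h
    rw [Sym2.mk_isDiag_iff] at hd
    subst hd
    simp only [Sym2.mem_iff, or_self] at h
    rw [h]

theorem numOrdinaryTo_eq_ncard_ends {u v : W} (huv : u ≠ v) :
    H.numOrdinaryTo u {v} = {d | H.ends d = s(u, v)}.ncard := by
  unfold numOrdinaryTo
  congr 1
  ext d
  simp only [Set.mem_singleton_iff, exists_eq_left, Set.mem_ofPred_eq]
  refine ⟨fun h => h.2.2, fun h => ⟨?_, huv.symm, h⟩⟩
  by_contra hk
  have := (H.isDiag_iff d).2 hk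
  rw [h, Sym2.mk_isDiag_iff] at this
  exact huv this

theorem numOrdinaryTo_preimage {v : W} {x : V} :
    G.numOrdinaryTo x (fV ⁻¹' {v}) =
      {e | G.kind e = EdgeKind.ordinary ∧ (G.ends e).map fV = s(fV x, v) ∧ x ∈ G.ends e}.ncard := by
  unfold numOrdinaryTo
  congr 1
  ext e
  simp only [Set.mem_preimage, Set.mem_singleton_iff, Set.mem_ofPred_eq]
  refine and_congr_right fun hk => ⟨?_, ?_⟩
  · rintro ⟨y, rfl, -, he⟩
    simp [he]
  · rintro ⟨hm, hx⟩
    obtain ⟨y, hy⟩ := Sym2.mem_iff_exists.1 hx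
    refine ⟨y, ?_, ?_, hy⟩
    · rw [hy, Sym2.map_mk, Sym2.congr_right] at hm
      exact hm
    · rintro rfl
      have := (G.isDiag_iff e).1 (by rw [hy]; exact Sym2.mk_isDiag_iff.2 rfl)
      exact this hk

/-- Describing semi-edges as non-loops with ends `s(u, u)` lets one set of colours, the non-loops
over `p`, serve for a vertex of `H` as well as for a pair of distinct vertices. -/
theorem numSemi_eq_ncard_ends (u : W) :
    H.numSemi u = {d | H.kind d ≠ EdgeKind.loop ∧ H.ends d = s(u, u)}.ncard := by
  unfold numSemi
  congr 1
  ext d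
  simp only [Set.mem_ofPred_eq]
  constructor
  · rintro ⟨hk, hu⟩
    exact ⟨by simp [hk], ends_eq_of_mem (by simp [hk]) hu⟩
  · rintro ⟨hk, hu⟩
    have := (kind_ne_ordinary_iff_exists (G := H) d).2 ⟨u, hu⟩
    refine ⟨?_, by simp [hu]⟩
    cases hd : H.kind d <;> simp_all

theorem numLoop_eq_ncard_ends (u : W) :
    H.numLoop u = {d | H.kind d = EdgeKind.loop ∧ H.ends d = s(u, u)}.ncard := by
  unfold numLoop
  congr 1
  ext d
  simp only [Set.mem_ofPred_eq]
  exact and_congr_right fun hk => ⟨fun hu => ends_eq_of_mem (by simp [hk]) hu,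
    fun hu => by simp [hu]⟩

theorem IsBipartite.numLoop_eq_zero (hG : G.IsBipartite) (x : V) : G.numLoop x = 0 := by
  simp [numLoop, hG.1]

/-- Since `G` has no loops, the edges at `x` over `fV x` are the semi-edges and the inner ordinary
edges, which condition `within` counts. -/
theorem ncard_fibre_edges [Finite E] (hG : G.IsBipartite) (hf : IsDegreeObedient G H fV) (x : V) :
    {e | (G.ends e).map fV = s(fV x, fV x) ∧ x ∈ G.ends e}.ncard =
      H.numSemi (fV x) + 2 * H.numLoop (fV x) := by
  rw [hf.within _ x rfl, hG.numLoop_eq_zero, numOrdinaryTo_preimage, mul_zero, add_zero, numSemi,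
    ← Set.ncard_union_eq _ (Set.toFinite _) (Set.toFinite _)]
  · congr 1
    ext e
    simp only [Set.mem_union, Set.mem_ofPred_eq]
    have := hG.1 e
    constructor
    · rintro ⟨hm, hx⟩
      cases hk : G.kind e <;> simp_all
    · rintro (⟨hk, hx⟩ | h)
      · refine ⟨?_, hx⟩
        rw [ends_eq_of_mem (by simp [hk]) hx, Sym2.map_mk]
      · exact h.2
  · rw [Set.disjoint_left]
    rintro e ⟨h1, -⟩ ⟨h2, -⟩
    simp [h1] at h2

/-- A loop factor of a bipartite graph extends to a covering projection. -/
theorem HasLoopFactor.extendsToCovering [Finite V] [Finite E] [Finite F] (hG : G.IsBipartite)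
    (hf : IsDegreeObedient G H fV) (hT : HasLoopFactor G H fV) : ExtendsToCovering G H fV := by
  classical
  obtain ⟨T, T_inner, T_deg⟩ := hT
  -- The colours are the loops at `p`, each in two versions: a vertex has to meet two edges over
  -- each loop. If `p` is not diagonal, there are neither colours nor edges.
  have col_loop : ∀ p : Sym2 W, ∃ col : {e | e ∈ T ∧ (G.ends e).map fV = p} →
      {d // H.kind d = EdgeKind.loop ∧ H.ends d = p} × Bool,
      ∀ x ∈ {x | fV x ∈ p}, ∀ c, ∃! e : {e | e ∈ T ∧ (G.ends e).map fV = p},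
        x ∈ G.ends e ∧ col e = c := by
    intro p
    refine hG.exists_colouring _ _ _ ?_ ?_
    · rintro e ⟨-, rfl⟩ x hx
      exact mem_map_ends hx
    · intro x hx
      rw [Nat.card_prod, Nat.card_eq_fintype_card (α := Bool), Fintype.card_bool]
      by_cases hp : p.IsDiag
      · have hp' : p = s(fV x, fV x) := by
          revert hp hx
          induction p with
          | _ a b =>
            intro hx hp
            rw [Sym2.mk_isDiag_iff] at hp
            subst hp
            simp only [Set.mem_ofPred_eq, Sym2.mem_iff, or_self] at hx
            rw [hx]
        have h1 : Nat.card {d // H.kind d = EdgeKind.loop ∧ H.ends d = p} =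
            H.numLoop (fV x) := by
          rw [numLoop_eq_ncard_ends, hp']; rfl
        rw [h1, mul_comm, ← T_deg]
        congr 1
        ext e
        simp only [Set.mem_ofPred_eq]
        refine ⟨fun h => ⟨h.1.1, h.2⟩, fun h => ⟨⟨h.1, ?_⟩, h.2⟩⟩
        rw [hp', map_ends_eq_of_mem (T_inner e h.1).2 h.2]
      · have h1 : IsEmpty {d // H.kind d = EdgeKind.loop ∧ H.ends d = p} :=
          ⟨fun ⟨d, hd, hd'⟩ => hp (hd' ▸ (H.isDiag_iff d).2 (by simp [hd]))⟩
        rw [Nat.card_of_isEmpty, zero_mul, Set.ncard_eq_zero]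
        refine Set.eq_empty_of_forall_notMem ?_
        rintro e ⟨⟨he, rfl⟩, -⟩
        exact hp (T_inner e he).2
  -- Outside `T` each vertex must meet one edge over each non-loop at `p`. On a diagonal `p` this is
  -- the fibre degree minus the degree in `T`; elsewhere it is condition `ordinary`.
  have col_rest : ∀ p : Sym2 W, ∃ col : {e | e ∉ T ∧ (G.ends e).map fV = p} →
      {d // H.kind d ≠ EdgeKind.loop ∧ H.ends d = p},
      ∀ x ∈ {x | fV x ∈ p}, ∀ c, ∃! e : {e | e ∉ T ∧ (G.ends e).map fV = p},
        x ∈ G.ends e ∧ col e = c := by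
    intro p
    refine hG.exists_colouring _ _ _ ?_ ?_
    · rintro e ⟨-, rfl⟩ x hx
      exact mem_map_ends hx
    · intro x hx
      obtain ⟨v, rfl⟩ := Sym2.mem_iff_exists.1 hx
      change _ = {d | H.kind d ≠ EdgeKind.loop ∧ H.ends d = s(fV x, v)}.ncard
      by_cases hv : fV x = v
      · subst hv
        rw [← numSemi_eq_ncard_ends]
        have h1 := ncard_fibre_edges hG hf x
        rw [← T_deg x] at h1
        have h2 : {e | (G.ends e).map fV = s(fV x, fV x) ∧ x ∈ G.ends e} =
            {e | e ∈ {e | e ∉ T ∧ (G.ends e).map fV = s(fV x, fV x)} ∧ x ∈ G.ends e} ∪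
            {e | e ∈ T ∧ x ∈ G.ends e} := by
          ext e
          simp only [Set.mem_ofPred_eq, Set.mem_union]
          have := fun h => map_ends_eq_of_mem (fV := fV) (x := x) (T_inner e h).2
          tauto
        rw [h2, Set.ncard_union_eq _ (Set.toFinite _) (Set.toFinite _)] at h1
        · omega
        · rw [Set.disjoint_left]
          rintro e ⟨⟨h, -⟩, -⟩ ⟨h', -⟩
          exact h h'
      · have h1 := hf.ordinary (fV x) v hv x rfl
        rw [numOrdinaryTo_eq_ncard_ends hv, numOrdinaryTo_preimage] at h1
        have h2 : {d | H.kind d ≠ EdgeKind.loop ∧ H.ends d = s(fV x, v)} =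
            {d | H.ends d = s(fV x, v)} := by
          ext d
          refine and_iff_right_of_imp fun h hk => ?_
          have := (H.isDiag_iff d).2 (by simp [hk])
          rw [h, Sym2.mk_isDiag_iff] at this
          exact hv this
        rw [h2, h1]
        congr 1
        ext e
        simp only [Set.mem_ofPred_eq]
        constructor
        · rintro ⟨⟨-, hm⟩, hx⟩
          refine ⟨?_, hm, hx⟩
          by_contra hk
          rw [ends_eq_of_mem hk hx, Sym2.map_mk, Sym2.congr_right] at hm
          exact hv hm
        · rintro ⟨-, hm, hx⟩
          refine ⟨⟨fun he => ?_, hm⟩, hx⟩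
          have := (T_inner e he).2
          rw [hm, Sym2.mk_isDiag_iff] at this
          exact hv this
  choose cl hcl using col_loop
  choose cr hcr using col_rest
  let fE : E → F := fun e => if he : e ∈ T then (cl _ ⟨e, he, rfl⟩).1.1 else (cr _ ⟨e, he, rfl⟩).1
  have fE_mem : ∀ p e (he : e ∈ T) (hp : (G.ends e).map fV = p),
      fE e = (cl p ⟨e, he, hp⟩).1.1 := by
    rintro _ e he rfl
    exact dif_pos he
  have fE_notMem : ∀ p e (he : e ∉ T) (hp : (G.ends e).map fV = p),
      fE e = (cr p ⟨e, he, hp⟩).1 := by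
    rintro _ e he rfl
    exact dif_neg he
  have ends_map : ∀ e, H.ends (fE e) = (G.ends e).map fV := by
    intro e
    by_cases he : e ∈ T
    · rw [fE_mem _ e he rfl]; exact (cl _ ⟨e, he, rfl⟩).1.2.2
    · rw [fE_notMem _ e he rfl]; exact (cr _ ⟨e, he, rfl⟩).2.2
  have mem_T_iff : ∀ e, e ∈ T ↔ H.kind (fE e) = EdgeKind.loop := by
    intro e
    by_cases he : e ∈ T
    · rw [fE_mem _ e he rfl]; exact iff_of_true he (cl _ ⟨e, he, rfl⟩).1.2.1
    · rw [fE_notMem _ e he rfl]; exact iff_of_false he (cr _ ⟨e, he, rfl⟩).2.1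
  have over_rest : ∀ d, H.kind d ≠ EdgeKind.loop → ∀ x, fV x ∈ H.ends d →
      ∃ e, ∀ e', (x ∈ G.ends e' ∧ fE e' = d) ↔ e' = e := by
    intro d hd x hx
    obtain ⟨⟨e, he, hp⟩, ⟨hxe, hce⟩, uniq⟩ := hcr _ x hx ⟨d, hd, rfl⟩
    refine ⟨e, fun e' => ⟨?_, ?_⟩⟩
    · rintro ⟨hx', rfl⟩
      have he' : e' ∉ T := fun h => hd ((mem_T_iff e').1 h)
      have := uniq ⟨e', he', (ends_map e').symm⟩
        ⟨hx', Subtype.ext (fE_notMem _ e' he' (ends_map e').symm).symm⟩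
      exact congrArg Subtype.val this
    · rintro rfl
      refine ⟨hxe, ?_⟩
      rw [fE_notMem _ _ he hp, hce]
  refine ⟨fE, fun e he => absurd he (hG.1 e), ?_, ends_map, ?_, ?_, ?_⟩
  · intro e he
    have h1 : e ∉ T := fun h => by simp [(T_inner e h).1] at he
    have h2 := fun h => h1 ((mem_T_iff e).2 h)
    -- A semi-edge lies outside `T`, so its image is not a loop; its image has only one end, so it
    -- is not ordinary either.
    have h3 : H.kind (fE e) ≠ EdgeKind.ordinary := by
      rw [kind_ne_ordinary_iff_exists, ends_map]
      obtain ⟨u, hu⟩ := (kind_ne_ordinary_iff_exists (G := G) e).1 (by simp [he])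
      exact ⟨fV u, by rw [hu, Sym2.map_mk]⟩
    cases hk : H.kind (fE e) <;> simp_all
  · intro d hd x hx
    refine Or.inr ⟨by simp [numOver, hG.1], ?_⟩
    obtain ⟨⟨e, he, hp⟩, ⟨hxe, hce⟩, uniq⟩ := hcl _ x hx (⟨d, hd, rfl⟩, true)
    obtain ⟨⟨e', he', hp'⟩, ⟨hxe', hce'⟩, uniq'⟩ := hcl _ x hx (⟨d, hd, rfl⟩, false)
    have hne : e ≠ e' := by
      rintro rfl
      have := hce.symm.trans hce'
      simp at this
    have : {a | G.kind a = EdgeKind.ordinary ∧ x ∈ G.ends a ∧ fE a = d} = {e, e'} := by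
      ext a
      simp only [Set.mem_ofPred_eq, Set.mem_insert_iff, Set.mem_singleton_iff]
      constructor
      · rintro ⟨-, hx', rfl⟩
        have ha : a ∈ T := (mem_T_iff a).2 hd
        have h1 : (cl _ ⟨a, ha, (ends_map a).symm⟩).1 = ⟨fE a, hd, rfl⟩ :=
          Subtype.ext (fE_mem _ a ha (ends_map a).symm).symm
        cases h2 : (cl _ ⟨a, ha, (ends_map a).symm⟩).2
        · exact Or.inr (congrArg Subtype.val (uniq' ⟨a, ha, (ends_map a).symm⟩
            ⟨hx', Prod.ext h1 h2⟩))
        · exact Or.inl (congrArg Subtype.val (uniq ⟨a, ha, (ends_map a).symm⟩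
            ⟨hx', Prod.ext h1 h2⟩))
      · rintro (rfl | rfl)
        · exact ⟨(T_inner _ he).1, hxe, by rw [fE_mem _ _ he hp, hce]⟩
        · exact ⟨(T_inner _ he').1, hxe', by rw [fE_mem _ _ he' hp', hce']⟩
    rw [numOver, this, Set.ncard_pair hne]
  · intro d hd x hx
    obtain ⟨e, he⟩ := over_rest d (by simp [hd]) x hx
    have hk := hG.1 e
    simp only [numOver, he]
    cases hke : G.kind e
    · refine Or.inl ⟨?_, ?_⟩
      · rw [Set.ncard_eq_one]
        exact ⟨e, by ext a; simp only [Set.mem_ofPred_eq, Set.mem_singleton_iff]; grind⟩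
      · rw [Set.ncard_eq_zero]
        ext a; simp only [Set.mem_ofPred_eq, Set.mem_empty_iff_false]; grind
    · refine Or.inr ⟨?_, ?_⟩
      · rw [Set.ncard_eq_zero]
        ext a; simp only [Set.mem_ofPred_eq, Set.mem_empty_iff_false]; grind
      · rw [Set.ncard_eq_one]
        exact ⟨e, by ext a; simp only [Set.mem_ofPred_eq, Set.mem_singleton_iff]; grind⟩
    · exact absurd hke hk
  · intro d hd x hx
    obtain ⟨e, he⟩ := over_rest d (by simp [hd]) x hx
    simp only [numOver, he]
    have hke : G.kind e = EdgeKind.ordinary := by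
      by_contra hk
      obtain ⟨u, hu⟩ := (kind_ne_ordinary_iff_exists (G := G) e).1 hk
      refine (kind_ne_ordinary_iff_exists (G := H) d).2 ⟨fV u, ?_⟩ hd
      rw [← ((he e).2 rfl).2, ends_map, hu, Sym2.map_mk]
    rw [Set.ncard_eq_one]
    exact ⟨e, by ext a; simp only [Set.mem_ofPred_eq, Set.mem_singleton_iff]; grind⟩

/-- The ordinary edges that a covering projection maps to loops form a loop factor. -/
theorem ExtendsToCovering.hasLoopFactor [Finite E] [Finite F] (hG : G.IsBipartite)
    (h : ExtendsToCovering G H fV) : HasLoopFactor G H fV := by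
  classical
  obtain ⟨fE, hE⟩ := h
  have := Fintype.ofFinite E
  have := Fintype.ofFinite F
  refine ⟨{e | G.kind e = EdgeKind.ordinary ∧ H.kind (fE e) = EdgeKind.loop}, ?_, fun x => ?_⟩
  · rintro e ⟨h1, h2⟩
    refine ⟨h1, ?_⟩
    rw [← hE.ends_map, H.isDiag_iff, h2]
    simp
  -- Count the edges of the factor at `x` by their images: each loop at `fV x` receives two ordinary
  -- edges, because `G` has no loops to use instead.
  · rw [numLoop, Set.ncard_eq_toFinset_card', Set.ncard_eq_toFinset_card',
      Finset.card_eq_sum_card_fiberwise (f := fE)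
        (t := {d | H.kind d = EdgeKind.loop ∧ fV x ∈ H.ends d}.toFinset), mul_comm]
    · refine Finset.sum_const_nat fun d hd => ?_
      simp only [Set.mem_toFinset, Set.mem_ofPred_eq] at hd
      rcases hE.over_loop d hd.1 x hd.2 with h | h
      · have h0 := h.1
        simp [numOver, hG.1] at h0
      · rw [← h.2, numOver, Set.ncard_eq_toFinset_card']
        congr 1
        ext e
        simp only [Finset.mem_filter, Set.mem_toFinset, Set.mem_ofPred_eq]
        constructor
        · rintro ⟨⟨⟨h1, h2⟩, h3⟩, h4⟩
          exact ⟨h1, h3, h4⟩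
        · rintro ⟨h1, h3, rfl⟩
          exact ⟨⟨⟨h1, hd.1⟩, h3⟩, rfl⟩
    · intro e he
      simp only [Set.coe_toFinset, Set.mem_ofPred_eq] at he ⊢
      refine ⟨he.1.2, ?_⟩
      rw [hE.ends_map]
      exact mem_map_ends he.2

/-! ### Fractional loop factors, and graphs without semi-edges -/

open scoped Classical in
/-- The ordinary edges inside the fibres of `fV`. -/
noncomputable def innerEdges [Fintype E] (G : SGraph V E) (fV : V → W) : Finset E :=
  Finset.univ.filter fun e => G.kind e = EdgeKind.ordinary ∧ ((G.ends e).map fV).IsDiag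

theorem mem_innerEdges [Fintype E] {e : E} : e ∈ G.innerEdges fV ↔
    G.kind e = EdgeKind.ordinary ∧ ((G.ends e).map fV).IsDiag := by
  simp [innerEdges]

open scoped Classical in
theorem card_innerEdges_mem [Fintype E] (x : V) :
    ((G.innerEdges fV).filter (x ∈ G.ends ·)).card = G.numOrdinaryTo x (fV ⁻¹' {fV x}) := by
  rw [numOrdinaryTo_preimage, ← Set.ncard_coe_finset]
  congr 1
  ext e
  simp only [Finset.coe_filter, mem_innerEdges, Set.mem_ofPred_eq]
  constructor
  · rintro ⟨⟨h1, h2⟩, h3⟩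
    exact ⟨h1, map_ends_eq_of_mem h2 h3, h3⟩
  · rintro ⟨h1, h2, h3⟩
    exact ⟨⟨h1, by rw [h2]; exact Sym2.mk_isDiag_iff.2 rfl⟩, h3⟩

-- The 2-colouring orients the inner edges from `true` to `false`, turning a loop factor into a
-- bipartite factor whose demand is 0 on the wrong colour class.
open scoped Classical in
theorem hasLoopFactor_of_fractional [Fintype V] [Fintype E] (hG : G.IsBipartite)
    (hf : IsDegreeObedient G H fV) (y : E → ℚ) (y_nonneg : ∀ e, 0 ≤ y e) (y_le : ∀ e, y e ≤ 1)
    (err : ∑ x, |∑ e ∈ G.innerEdges fV with x ∈ G.ends e, y e - (2 * H.numLoop (fV x) : ℕ)| < 1) :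
    HasLoopFactor G H fV := by
  obtain ⟨c, t, f, h_ends, h_ord, -⟩ := hG.exists_ends
  -- This is where condition `semi_le` enters: with at most as many semi-edges at `x` as at `fV x`,
  -- enough inner edges remain.
  have le_deg : ∀ x, 2 * H.numLoop (fV x) ≤ ((G.innerEdges fV).filter (x ∈ G.ends ·)).card := by
    intro x
    have h1 := hf.within _ x rfl
    have h2 := hf.semi_le _ x rfl
    rw [hG.numLoop_eq_zero] at h1
    rw [card_innerEdges_mem]
    omega
  have t_true : ∀ T ⊆ G.innerEdges fV, ∀ x, c x = true →
      T.filter (t · = x) = T.filter (x ∈ G.ends ·) := by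
    intro T hT x hx
    refine Finset.filter_congr fun e he => ?_
    have := h_ord e (mem_innerEdges.1 (hT he)).1
    rw [h_ends, Sym2.mem_iff]
    grind
  have f_false : ∀ T ⊆ G.innerEdges fV, ∀ x, c x = false →
      T.filter (f · = x) = T.filter (x ∈ G.ends ·) := by
    intro T hT x hx
    refine Finset.filter_congr fun e he => ?_
    have := h_ord e (mem_innerEdges.1 (hT he)).1
    rw [h_ends, Sym2.mem_iff]
    grind
  have t_false : ∀ x, c x = false → (G.innerEdges fV).filter (t · = x) = ∅ := by
    intro x hx
    refine Finset.filter_eq_empty_iff.2 fun {e} he => ?_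
    have := h_ord e (mem_innerEdges.1 he).1
    grind
  have f_true : ∀ x, c x = true → (G.innerEdges fV).filter (f · = x) = ∅ := by
    intro x hx
    refine Finset.filter_eq_empty_iff.2 fun {e} he => ?_
    have := h_ord e (mem_innerEdges.1 he).1
    grind
  obtain ⟨T, hT, h1, h2⟩ := exists_factor_of_fractional t f (G.innerEdges fV)
    (fun x => if c x then 2 * H.numLoop (fV x) else 0)
    (fun x => if c x then 0 else 2 * H.numLoop (fV x)) y (fun e _ => y_nonneg e)
    (fun e _ => y_le e)
    (fun x => by
      cases hx : c x
      · simp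
      · simpa only [if_true, t_true _ subset_rfl x hx] using le_deg x)
    (by
      rw [← Finset.sum_add_distrib]
      refine lt_of_eq_of_lt (Finset.sum_congr rfl fun x _ => ?_) err
      cases hx : c x
      · simp [t_false x hx, f_false _ subset_rfl x hx]
      · simp [f_true x hx, t_true _ subset_rfl x hx])
  refine ⟨T, fun e he => mem_innerEdges.1 (hT he), fun x => ?_⟩
  have h3 : {e | e ∈ (T : Set E) ∧ x ∈ G.ends e} = (T.filter (x ∈ G.ends ·) : Finset E) := by
    ext e; simp
  rw [h3, Set.ncard_coe_finset]
  cases hx : c x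
  · have := h2 x
    rw [f_false T hT x hx] at this
    simpa [hx] using this
  · have := h1 x
    rw [t_true T hT x hx] at this
    simpa [hx] using this

/-- Without semi-edges all vertices of a fibre have the same inner degree, so giving every inner
edge the ratio of required to available degree meets all demands exactly. -/
theorem IsBipartite.extendsToCovering_of_noSemiEdges [Finite V] [Finite E] [Finite F]
    (hG : G.IsBipartite) (h : G.NoSemiEdges) (hf : IsDegreeObedient G H fV) :
    ExtendsToCovering G H fV := by
  classical
  have := Fintype.ofFinite V
  have := Fintype.ofFinite E
  refine HasLoopFactor.extendsToCovering hG hf ?_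
  have : ∀ e, ∃ x, x ∈ G.ends e := fun e =>
    Sym2.ind (f := fun p => ∃ x, x ∈ p) (fun a b => ⟨a, by simp⟩) (G.ends e)
  choose z hz using this
  let q : W → ℚ := fun u => (2 * H.numLoop u : ℕ) / (H.numSemi u + 2 * H.numLoop u : ℕ)
  refine hasLoopFactor_of_fractional hG hf (fun e => q (fV (z e)))
    (fun e => by positivity) (fun e => div_le_one_of_le₀ ?_ (by positivity)) ?_
  · exact_mod_cast Nat.le_add_left _ _
  · refine lt_of_eq_of_lt (Finset.sum_eq_zero fun x _ => ?_) zero_lt_one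
    have h1 : ∀ e ∈ (G.innerEdges fV).filter (x ∈ G.ends ·), q (fV (z e)) = q (fV x) := by
      intro e he
      obtain ⟨he, hx⟩ := Finset.mem_filter.1 he
      have := (map_ends_eq_of_mem (mem_innerEdges.1 he).2 hx).symm.trans
        (map_ends_eq_of_mem (mem_innerEdges.1 he).2 (hz e))
      simp only [Sym2.eq_iff, or_self, and_self] at this
      rw [this]
    have h2 : G.numSemi x = 0 := by
      have := h
      simp only [NoSemiEdges] at this
      simp [numSemi, this]
    have h3 := hf.within _ x rfl
    rw [hG.numLoop_eq_zero, h2, ← card_innerEdges_mem, mul_zero, zero_add, zero_add] at h3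
    rw [Finset.sum_congr rfl h1, Finset.sum_const, ← h3, nsmul_eq_mul, abs_eq_zero, sub_eq_zero]
    -- If the inner degree is 0, the ratio is 0 by the convention for division by zero, and the
    -- demand is 0 too.
    by_cases h0 : H.numSemi (fV x) + 2 * H.numLoop (fV x) = 0
    · have : H.numLoop (fV x) = 0 := by omega
      simp [q, this]
    · exact mul_div_cancel₀ _ (Nat.cast_ne_zero.2 h0)

/-! ### Local search: energy of integer weights -/

section Balance

variable [Fintype E]

open scoped Classical in
/-- The total weight of the edges that join `x` to its fibre. -/
noncomputable def load (G : SGraph V E) (fV : V → W) (y : E → ℕ) (x : V) : ℕ :=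
  ∑ e ∈ G.innerEdges fV with x ∈ G.ends e, y e

/-- The deviation of the load of `x` from `K` times the degree of `x` in a loop factor. -/
noncomputable def excess (G : SGraph V E) (H : SGraph W F) (fV : V → W) (K : ℕ) (y : E → ℕ)
    (x : V) : ℤ :=
  G.load fV y x - 2 * (K * H.numLoop (fV x) : ℕ)

/-- The sum of the squares of all deviations. -/
noncomputable def energy [Fintype V] (G : SGraph V E) (H : SGraph W F) (fV : V → W) (K : ℕ)
    (y : E → ℕ) : ℕ :=
  ∑ x, (G.excess H fV K y x).natAbs ^ 2

/-- Changing the weight of `e` by one does not decrease the energy. -/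
def IsBalanced (G : SGraph V E) (H : SGraph W F) (fV : V → W) (K : ℕ) (y : E → ℕ) (e : E) : Prop :=
  ∀ a b, G.ends e = s(a, b) →
    (0 < y e → G.excess H fV K y a + G.excess H fV K y b ≤ 1) ∧
    (y e < K → -1 ≤ G.excess H fV K y a + G.excess H fV K y b)

theorem load_update [DecidableEq V] [DecidableEq E] {e : E} (he : e ∈ G.innerEdges fV) (y : E → ℕ)
    (v : ℕ) (x : V) :
    G.load fV (Function.update y e v) x + (if x ∈ G.ends e then y e else 0) =
      G.load fV y x + (if x ∈ G.ends e then v else 0) := by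
  unfold load
  split_ifs with hx
  · have key : ∀ S : Finset E, e ∈ S →
        ∑ i ∈ S, Function.update y e v i + y e = ∑ i ∈ S, y i + v := by
      intro S hS
      rw [Finset.sum_update_of_mem hS, ← Finset.erase_eq, ← Finset.sum_erase_add _ _ hS]
      omega
    refine key _ ?_
    simp [he, hx]
  · rw [Finset.sum_update_of_notMem (by simp [hx])]

theorem energy_cast [Fintype V] (K : ℕ) (y : E → ℕ) :
    (G.energy H fV K y : ℤ) = ∑ x, G.excess H fV K y x ^ 2 := by
  simp [energy]

theorem sum_sq_sub_sum_sq_of_eq_off_pair [Fintype V] {f g : V → ℤ} {a b : V} (hab : a ≠ b)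
    (h : ∀ x, x ≠ a → x ≠ b → f x = g x) :
    ∑ x, f x ^ 2 - ∑ x, g x ^ 2 = (f a ^ 2 - g a ^ 2) + (f b ^ 2 - g b ^ 2) := by
  classical
  rw [← Finset.sum_sub_distrib, ← Finset.sum_pair (f := fun x => f x ^ 2 - g x ^ 2) hab]
  symm
  refine Finset.sum_subset (Finset.subset_univ _) fun x _ hx => ?_
  simp only [Finset.mem_insert, Finset.mem_singleton, not_or] at hx
  rw [h x hx.1 hx.2, sub_self]

/-- If `s` is the sum of the two excesses, raising the weight changes the energy by `2 * s + 2` and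
lowering it by `2 - 2 * s`. In the cases allowed by `hv` this is at most `-2`. -/
theorem energy_update_lt [Fintype V] [DecidableEq E] {K : ℕ} {y : E → ℕ} {e : E} {a b : V} {v : ℕ}
    (he : e ∈ G.innerEdges fV) (hab : G.ends e = s(a, b)) (hne : a ≠ b)
    (hv : (v = y e + 1 ∧ G.excess H fV K y a + G.excess H fV K y b ≤ -2) ∨
      (v + 1 = y e ∧ 2 ≤ G.excess H fV K y a + G.excess H fV K y b)) :
    G.energy H fV K (Function.update y e v) < G.energy H fV K y := by
  classical
  have h_off : ∀ x, x ≠ a → x ≠ b →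
      G.excess H fV K (Function.update y e v) x = G.excess H fV K y x := by
    intro x ha hb
    have := load_update he y v x
    rw [if_neg (by simp [hab, ha, hb]), if_neg (by simp [hab, ha, hb])] at this
    simp only [excess]
    omega
  have h_on : ∀ x ∈ G.ends e, G.excess H fV K (Function.update y e v) x + y e =
      G.excess H fV K y x + v := by
    intro x hx
    have := load_update he y v x
    rw [if_pos hx, if_pos hx] at this
    simp only [excess]
    omega
  have ha := h_on a (by simp [hab])
  have hb := h_on b (by simp [hab])
  have := sum_sq_sub_sum_sq_of_eq_off_pair hne h_off
  rw [← Int.ofNat_lt, energy_cast, energy_cast]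
  rcases hv with ⟨rfl, h⟩ | ⟨h', h⟩
  · have ha' : G.excess H fV K (Function.update y e (y e + 1)) a = G.excess H fV K y a + 1 := by
      push_cast at ha; linarith
    have hb' : G.excess H fV K (Function.update y e (y e + 1)) b = G.excess H fV K y b + 1 := by
      push_cast at hb; linarith
    rw [ha', hb'] at this
    linarith
  · have hv : (y e : ℤ) = v + 1 := by exact_mod_cast h'.symm
    have ha' : G.excess H fV K (Function.update y e v) a = G.excess H fV K y a - 1 := by linarith
    have hb' : G.excess H fV K (Function.update y e v) b = G.excess H fV K y b - 1 := by linarith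
    rw [ha', hb'] at this
    linarith

/-- If there is a loop factor, then balanced weights have small energy. -/
theorem HasLoopFactor.energy_le [Fintype V] (hT : HasLoopFactor G H fV) {K : ℕ} {y : E → ℕ}
    (y_le : ∀ e, y e ≤ K) (hy : ∀ e ∈ G.innerEdges fV, IsBalanced G H fV K y e) :
    G.energy H fV K y ≤ Fintype.card E * K := by
  classical
  obtain ⟨T, T_inner, T_deg⟩ := hT
  -- The scaled indicator of the factor has excess 0 everywhere, so the excess of `y` at `x` is the
  -- sum of `y e - z e` over the inner edges at `x`.
  let z : E → ℕ := fun e => if e ∈ T then K else 0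
  have hz : ∀ x, (2 * (K * H.numLoop (fV x) : ℕ) : ℤ) =
      ∑ e ∈ G.innerEdges fV with x ∈ G.ends e, (z e : ℤ) := by
    intro x
    have h1 : {e | e ∈ T ∧ x ∈ G.ends e} =
        (((G.innerEdges fV).filter (x ∈ G.ends ·)).filter (· ∈ T) : Finset E) := by
      ext e
      simp only [Set.mem_ofPred_eq, Finset.coe_filter, Finset.mem_filter, mem_innerEdges]
      have := T_inner e
      tauto
    have h2 := T_deg x
    rw [h1, Set.ncard_coe_finset] at h2
    have h3 : ∑ e ∈ G.innerEdges fV with x ∈ G.ends e, z e = 2 * (K * H.numLoop (fV x)) := by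
      simp only [z]
      rw [← Finset.sum_filter, Finset.sum_const, h2, smul_eq_mul]
      ring
    exact_mod_cast h3.symm
  have h_ex : ∀ x, G.excess H fV K y x =
      ∑ e ∈ G.innerEdges fV with x ∈ G.ends e, ((y e : ℤ) - z e) := by
    intro x
    rw [Finset.sum_sub_distrib, ← hz, excess, load]
    push_cast
    rfl
  have main : (G.energy H fV K y : ℤ) ≤ ∑ e ∈ G.innerEdges fV, (K : ℤ) := by
    -- Replace one factor of each square by that sum and exchange the summations: an edge
    -- contributes the sum of the excesses at its ends times `y e - z e`.
    calc (G.energy H fV K y : ℤ)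
        = ∑ x, ∑ e ∈ G.innerEdges fV,
            if x ∈ G.ends e then G.excess H fV K y x * ((y e : ℤ) - z e) else 0 := by
          rw [energy_cast]
          refine Finset.sum_congr rfl fun x _ => ?_
          rw [← Finset.sum_filter, ← Finset.mul_sum, ← h_ex, sq]
      _ = ∑ e ∈ G.innerEdges fV, ∑ x,
            if x ∈ G.ends e then G.excess H fV K y x * ((y e : ℤ) - z e) else 0 :=
          Finset.sum_comm
      _ ≤ ∑ e ∈ G.innerEdges fV, (K : ℤ) := by
          refine Finset.sum_le_sum fun e he => ?_
          obtain ⟨a, b, hab⟩ : ∃ a b, G.ends e = s(a, b) :=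
            Sym2.ind (f := fun p => ∃ a b, p = s(a, b)) (fun a b => ⟨a, b, rfl⟩) (G.ends e)
          have hne : a ≠ b := by
            intro h
            refine (G.isDiag_iff e).1 ?_ (mem_innerEdges.1 he).1
            rw [hab, h]
            exact Sym2.mk_isDiag_iff.2 rfl
          have h1 : (Finset.univ.filter (· ∈ G.ends e)) = {a, b} := by
            ext x; simp [hab]
          rw [← Finset.sum_filter, h1, Finset.sum_pair hne, ← add_mul]
          have h2 := hy e he a b hab
          have h3 : (y e : ℤ) ≤ K := by exact_mod_cast y_le e
          have h4 : (0 : ℤ) ≤ y e := by positivity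
          -- On `T` the difference is nonpositive, and if it is nonzero the weight could be raised,
          -- so the excess sum is at least `-1`; off `T` symmetrically. Each edge contributes at
          -- most `K`.
          by_cases heT : e ∈ T
          · simp only [z, heT, if_true]
            by_cases h5 : y e < K
            · have := h2.2 h5
              nlinarith
            · have : (y e : ℤ) = K := by exact_mod_cast le_antisymm (y_le e) (not_lt.1 h5)
              rw [this, sub_self, mul_zero]
              positivity
          · simp only [z, heT, if_false, Nat.cast_zero, sub_zero]
            by_cases h5 : 0 < y e
            · have := h2.1 h5
              nlinarith
            · have : (y e : ℤ) = 0 := by exact_mod_cast Nat.eq_zero_of_not_pos h5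
              rw [this, mul_zero]
              positivity
  rw [Finset.sum_const, nsmul_eq_mul] at main
  have h1 : G.energy H fV K y ≤ (G.innerEdges fV).card * K := by exact_mod_cast main
  exact h1.trans (Nat.mul_le_mul_right _ (Finset.card_le_univ _))

/-- By Cauchy–Schwarz the square of the total deviation is at most `|V| * |E| * K`, which is less
than `K ^ 2`. -/
theorem HasLoopFactor.sum_excess_lt [Fintype V] (hT : HasLoopFactor G H fV) {K : ℕ} {y : E → ℕ}
    (hK : Fintype.card V * Fintype.card E < K)
    (y_le : ∀ e, y e ≤ K) (hy : ∀ e ∈ G.innerEdges fV, IsBalanced G H fV K y e) :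
    ∑ x, (G.excess H fV K y x).natAbs < K := by
  have h1 := hT.energy_le y_le hy
  have h2 : (∑ x, (G.excess H fV K y x).natAbs) ^ 2 ≤ Fintype.card V * G.energy H fV K y :=
    sq_sum_le_card_mul_sum_sq
  by_contra! h3
  have h4 : K ^ 2 ≤ Fintype.card V * Fintype.card E * K := by
    rw [mul_assoc]
    exact (Nat.pow_le_pow_left h3 2).trans (h2.trans (Nat.mul_le_mul_left _ h1))
  nlinarith

/-- Dividing the weights by `K` yields a fractional factor of total error below 1. -/
theorem hasLoopFactor_of_sum_excess_lt [Fintype V] (hG : G.IsBipartite)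
    (hf : IsDegreeObedient G H fV) {K : ℕ} {y : E → ℕ} (y_le : ∀ e, y e ≤ K)
    (h : ∑ x, (G.excess H fV K y x).natAbs < K) : HasLoopFactor G H fV := by
  classical
  have hK : (0 : ℚ) < K := by exact_mod_cast (Nat.zero_le _).trans_lt h
  refine hasLoopFactor_of_fractional hG hf (fun e => (y e : ℚ) / K) (fun e => by positivity)
    (fun e => div_le_one_of_le₀ (by exact_mod_cast y_le e) hK.le) ?_
  have h1 : ∀ x, |∑ e ∈ G.innerEdges fV with x ∈ G.ends e, (y e : ℚ) / K -
      (2 * H.numLoop (fV x) : ℕ)| = ((G.excess H fV K y x).natAbs : ℚ) / K := by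
    intro x
    rw [Nat.cast_natAbs, Int.cast_abs, ← abs_of_pos hK, ← abs_div, abs_of_pos hK,
      ← Finset.sum_div]
    congr 1
    rw [eq_div_iff hK.ne', sub_mul, div_mul_cancel₀ _ hK.ne', excess, load]
    push_cast
    ring
  rw [Finset.sum_congr rfl fun x _ => h1 x, ← Finset.sum_div, div_lt_one hK]
  exact_mod_cast h

theorem energy_zero_le [Fintype V] [Fintype F] (K : ℕ) :
    G.energy H fV K (fun _ => 0) ≤ Fintype.card V * (2 * (K * Fintype.card F)) ^ 2 := by
  refine (Finset.sum_le_card_nsmul _ _ ((2 * (K * Fintype.card F)) ^ 2) fun x _ => ?_).trans_eq ?_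
  · refine Nat.pow_le_pow_left ?_ 2
    have : H.numLoop (fV x) ≤ Fintype.card F := by
      rw [numLoop, ← Nat.card_eq_fintype_card, ← Set.ncard_univ]
      exact Set.ncard_le_ncard (Set.subset_univ _) (Set.toFinite _)
    have h2 := Nat.mul_le_mul_left K this
    simp only [excess, load, Finset.sum_const_zero]
    omega
  · simp

end Balance

end SGraph

/-! ### Reasoning about programs: running time and correctness -/

namespace RAM

/-- The program has no loops. -/
def Program.LoopFree : Program → Prop
  | .seq p q => p.LoopFree ∧ q.LoopFree
  | .ite _ p q => p.LoopFree ∧ q.LoopFree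
  | .loop _ _ => False
  | _ => True

/-- The result of a program without loops. -/
def Program.eval : Program → Store → Store
  | .skip, s => s
  | .const x c, s => s.setReg x c
  | .add x y z, s => s.setReg x (s.reg y + s.reg z)
  | .sub x y z, s => s.setReg x (s.reg y - s.reg z)
  | .load x a y, s => s.setReg x (s.mem a (s.reg y))
  | .store a y x, s => s.setMem a (s.reg y) (s.reg x)
  | .seq p q, s => q.eval (p.eval s)
  | .ite x p q, s => if s.reg x ≠ 0 then p.eval s else q.eval s
  | .loop _ _, s => s

/-- An upper bound for the number of steps of a program without loops. -/
def Program.cost : Program → ℕ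
  | .seq p q => p.cost + q.cost
  | .ite _ p q => p.cost + q.cost + 1
  | _ => 1

theorem Program.LoopFree.exec {p : Program} (hp : p.LoopFree) (s : Store) :
    ∃ t ≤ p.cost, Exec p s (p.eval s) t := by
  induction p generalizing s with
  | skip => exact ⟨1, le_rfl, .skip s⟩
  | const x c => exact ⟨1, le_rfl, .const s x c⟩
  | add x y z => exact ⟨1, le_rfl, .add s x y z⟩
  | sub x y z => exact ⟨1, le_rfl, .sub s x y z⟩
  | load x a y => exact ⟨1, le_rfl, .load s x a y⟩
  | store a y x => exact ⟨1, le_rfl, .store s a y x⟩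
  | seq p q ihp ihq =>
    obtain ⟨t₁, h₁, e₁⟩ := ihp hp.1 s
    obtain ⟨t₂, h₂, e₂⟩ := ihq hp.2 (p.eval s)
    exact ⟨t₁ + t₂, Nat.add_le_add h₁ h₂, .seq e₁ e₂⟩
  | ite x p q ihp ihq =>
    by_cases hx : s.reg x ≠ 0
    · obtain ⟨t, h, e⟩ := ihp hp.1 s
      refine ⟨t + 1, by simp only [Program.cost]; omega, ?_⟩
      rw [Program.eval, if_pos hx]
      exact .ite_true hx e
    · obtain ⟨t, h, e⟩ := ihq hp.2 s
      refine ⟨t + 1, by simp only [Program.cost]; omega, ?_⟩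
      rw [Program.eval, if_neg hx]
      exact .ite_false (not_not.1 hx) e
  | loop x p => exact hp.elim

/-- Started in `s`, the program halts within `B` steps in a store that satisfies `Q`. -/
def Runs (p : Program) (s : Store) (B : ℕ) (Q : Store → Prop) : Prop :=
  ∃ s' t, Exec p s s' t ∧ t ≤ B ∧ Q s'

theorem Runs.of_loopFree {p : Program} {s : Store} {Q : Store → Prop} (hp : p.LoopFree)
    (hQ : Q (p.eval s)) : Runs p s p.cost Q := by
  obtain ⟨t, ht, e⟩ := hp.exec s
  exact ⟨_, t, e, ht, hQ⟩

theorem Runs.mono {p : Program} {s : Store} {B B' : ℕ} {Q Q' : Store → Prop} (h : Runs p s B Q)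
    (hB : B ≤ B') (hQ : ∀ s', Q s' → Q' s') : Runs p s B' Q' := by
  obtain ⟨s', t, e, ht, hs⟩ := h
  exact ⟨s', t, e, ht.trans hB, hQ _ hs⟩

theorem Runs.seq {p q : Program} {s : Store} {B₁ B₂ : ℕ} {Q R : Store → Prop}
    (h₁ : Runs p s B₁ R) (h₂ : ∀ s', R s' → Runs q s' B₂ Q) : Runs (.seq p q) s (B₁ + B₂) Q := by
  obtain ⟨s₁, t₁, e₁, ht₁, hs₁⟩ := h₁
  obtain ⟨s₂, t₂, e₂, ht₂, hs₂⟩ := h₂ s₁ hs₁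
  exact ⟨s₂, t₁ + t₂, .seq e₁ e₂, Nat.add_le_add ht₁ ht₂, hs₂⟩

/-- A loop with an invariant that contains a bound for the number of the remaining rounds. -/
theorem Runs.loop {x : ℕ} {p : Program} {B : ℕ} {J : ℕ → Store → Prop}
    (step : ∀ k s, J k s → s.reg x ≠ 0 → Runs p s B fun s' => ∃ k' < k, J k' s')
    {k : ℕ} {s : Store} (h : J k s) :
    Runs (.loop x p) s (k * (B + 1) + 1) fun s' => s'.reg x = 0 ∧ ∃ k', J k' s' := by
  induction k using Nat.strong_induction_on generalizing s with
  | _ k ih =>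
    by_cases hx : s.reg x = 0
    · exact ⟨s, 1, .loop_done hx, by omega, hx, k, h⟩
    · obtain ⟨s₁, t₁, e₁, ht₁, k', hk', hs₁⟩ := step k s h hx
      obtain ⟨s₂, t₂, e₂, ht₂, hs₂⟩ := ih k' hk' hs₁
      refine ⟨s₂, t₁ + t₂ + 1, .loop_again hx e₁ e₂, ?_, hs₂⟩
      have : (k' + 1) * (B + 1) ≤ k * (B + 1) := Nat.mul_le_mul_right _ hk'
      rw [Nat.add_mul] at this
      omega

/-- A loop that counts down the register `x`. -/
theorem Runs.countdown {x : ℕ} {p : Program} {B : ℕ} {J : ℕ → Store → Prop}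
    (step : ∀ k s, J (k + 1) s → s.reg x = k + 1 → Runs p s B fun s' => J k s' ∧ s'.reg x = k)
    {k : ℕ} {s : Store} (hk : s.reg x = k) (h : J k s) :
    Runs (.loop x p) s (k * (B + 1) + 1) (J 0) := by
  refine (Runs.loop (J := fun k s => s.reg x = k ∧ J k s) (B := B) ?_ ⟨hk, h⟩).mono le_rfl ?_
  · rintro k s ⟨hk, hJ⟩ hx
    obtain ⟨j, rfl⟩ := Nat.exists_eq_succ_of_ne_zero (hk ▸ hx)
    exact (step j s hJ hk).mono le_rfl fun s' hs' => ⟨j, Nat.lt_succ_self j, hs'.2, hs'.1⟩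
  · rintro s' ⟨h0, k', hk', hJ⟩
    obtain rfl : k' = 0 := hk'.symm.trans h0
    exact hJ

@[simp] theorem Store.setReg_reg (s : Store) (x c y : ℕ) :
    (s.setReg x c).reg y = if y = x then c else s.reg y := by
  simp [Store.setReg, Function.update_apply]

@[simp] theorem Store.setReg_mem (s : Store) (x c : ℕ) : (s.setReg x c).mem = s.mem := rfl

@[simp] theorem Store.setMem_reg (s : Store) (a i c : ℕ) : (s.setMem a i c).reg = s.reg := rfl

@[simp] theorem Store.setMem_mem (s : Store) (a i c b : ℕ) :
    (s.setMem a i c).mem b = if b = a then Function.update (s.mem a) i c else s.mem b := by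
  simp [Store.setMem, Function.update_apply]

/-- Run the programs of a list one after the other. -/
def block : List Program → Program
  | [] => .skip
  | [p] => p
  | p :: q :: l => .seq p (block (q :: l))

/-- The registers to which the program writes. -/
def Program.regsWritten : Program → List ℕ
  | .const x _ | .add x _ _ | .sub x _ _ | .load x _ _ => [x]
  | .seq p q | .ite _ p q => p.regsWritten ++ q.regsWritten
  | .loop _ p => p.regsWritten
  | _ => []

/-- The memory banks to which the program writes. -/
def Program.banksWritten : Program → List ℕ
  | .store a _ _ => [a]
  | .seq p q | .ite _ p q => p.banksWritten ++ q.banksWritten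
  | .loop _ p => p.banksWritten
  | _ => []

/-- A frame rule: for concrete programs the hypothesis is decidable, so untouched registers require
no symbolic execution. -/
theorem Program.eval_reg_of_notMem {p : Program} {r : ℕ} (h : r ∉ p.regsWritten) (s : Store) :
    (p.eval s).reg r = s.reg r := by
  induction p generalizing s with
  | seq p q ihp ihq =>
    simp only [Program.regsWritten, List.mem_append, not_or] at h
    rw [Program.eval, ihq h.2, ihp h.1]
  | ite x p q ihp ihq =>
    simp only [Program.regsWritten, List.mem_append, not_or] at h
    rw [Program.eval]
    split_ifs
    · exact ihp h.1 s
    · exact ihq h.2 s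
  | _ => simp_all [Program.regsWritten, Program.eval]

theorem Program.eval_mem_of_notMem {p : Program} {b : ℕ} (h : b ∉ p.banksWritten) (s : Store) :
    (p.eval s).mem b = s.mem b := by
  induction p generalizing s with
  | seq p q ihp ihq =>
    simp only [Program.banksWritten, List.mem_append, not_or] at h
    rw [Program.eval, ihq h.2, ihp h.1]
  | ite x p q ihp ihq =>
    simp only [Program.banksWritten, List.mem_append, not_or] at h
    rw [Program.eval]
    split_ifs
    · exact ihp h.1 s
    · exact ihq h.2 s
  | _ => simp_all [Program.banksWritten, Program.eval]

end RAM

theorem Fin.sum_ite_val_lt_succ {n : ℕ} (f : Fin n → ℕ) (i : Fin n) :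
    ∑ x : Fin n, (if (x : ℕ) < i + 1 then f x else 0) =
      ∑ x : Fin n, (if (x : ℕ) < i then f x else 0) + f i := by
  have : ∀ x : Fin n, (if (x : ℕ) < i + 1 then f x else 0) =
      (if (x : ℕ) < i then f x else 0) + if x = i then f x else 0 := by
    intro x
    rcases lt_trichotomy (x : ℕ) i with h | h | h
    · simp [h, Nat.lt_succ_of_lt h, Fin.ext_iff, h.ne]
    · simp [Fin.ext h]
    · simp [h.not_gt, show ¬ (x : ℕ) < i + 1 by omega, Fin.ext_iff, h.ne']
  rw [Finset.sum_congr rfl fun x _ => this x, Finset.sum_add_distrib]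
  simp

theorem Sym2.mk_inf_sup {α : Type*} [LinearOrder α] (p : Sym2 α) : s(p.inf, p.sup) = p :=
  Sym2.sortEquiv.left_inv p

/-! ### The input format and the program -/

namespace ExtensionInstance

open RAM SGraph

section Input

variable (I : ExtensionInstance)

/-- The store in which the machine starts on the instance. -/
abbrev init : Store := initStore I.encode

/-- The input has nine lists, so registers from 9 on start at 0. Register 9 stays 0, and adding it
copies a register. -/
theorem init_reg : I.init.reg 0 = I.n ∧ I.init.reg 1 = I.m ∧ I.init.reg 5 = I.m' ∧
    ∀ r, 9 ≤ r → I.init.reg r = 0 := by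
  refine ⟨?_, ?_, ?_, fun r hr => ?_⟩
  · simp [init, initStore, encode, SGraph.encode]
  · simp [init, initStore, encode, SGraph.encode]
  · simp [init, initStore, encode, SGraph.encode]
  · obtain ⟨r, rfl⟩ := Nat.exists_eq_add_of_le' hr
    simp [init, initStore, encode, SGraph.encode]

theorem init_mem_of_le {b : ℕ} (hb : 9 ≤ b) : I.init.mem b = fun _ => 0 := by
  obtain ⟨b, rfl⟩ := Nat.exists_eq_add_of_le' hb
  funext j
  simp [init, initStore, encode, SGraph.encode]

theorem init_mem_G (e : Fin I.m) : I.init.mem 1 e = (I.G.kind e).code ∧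
    I.init.mem 2 e = ((I.G.ends e).inf : ℕ) ∧ I.init.mem 3 e = ((I.G.ends e).sup : ℕ) := by
  simp [init, initStore, encode, SGraph.encode]

theorem init_mem_H (d : Fin I.m') : I.init.mem 5 d = (I.H.kind d).code ∧
    I.init.mem 6 d = ((I.H.ends d).inf : ℕ) := by
  simp [init, initStore, encode, SGraph.encode]

theorem init_mem_fV (x : Fin I.n) : I.init.mem 8 x = (I.fV x : ℕ) := by
  simp [init, initStore, encode, SGraph.encode]

/-- Every number in the input costs at least 1, so the size bounds the length of each list. The
vertex list of `G` is in the input so that its length gives `n`. -/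
theorem le_inputSize : I.n ≤ inputSize I.encode ∧ I.m ≤ inputSize I.encode ∧
    I.m' ≤ inputSize I.encode := by
  have key : ∀ l ∈ I.encode, l.length ≤ inputSize I.encode := by
    intro l hl
    have h1 : l.length ≤ I.encode.flatten.length := by
      rw [List.length_flatten]
      exact List.single_le_sum (by simp) _ (List.mem_map_of_mem hl)
    refine h1.trans ?_
    rw [inputSize, ← List.length_map (f := fun x : ℕ => x.size + 1)]
    refine List.length_le_sum_of_one_le _ fun i hi => ?_
    obtain ⟨x, -, rfl⟩ := List.mem_map.1 hi
    omega
  refine ⟨?_, ?_, ?_⟩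
  · simpa using key (List.range I.n) (by simp [encode, SGraph.encode])
  · simpa using key (List.ofFn fun e => (I.G.kind e).code) (by simp [encode, SGraph.encode])
  · simpa using key (List.ofFn fun e => (I.H.kind e).code) (by simp [encode, SGraph.encode])

end Input

/-! The program. Bank `10` holds the loads that the vertices of a fibre should get, bank `11` the
weights of the edges and bank `12` the loads of the vertices; register `10` holds `1`, register `11`
the greatest weight `n * m + 1`, register `12` the current edge and register `16` whether a
weight has changed. -/

/-- Prepare the computation of the greatest weight. -/
def setup : Program := block [.const 10 1, .const 11 1, .add 12 0 9]

/-- One round of the computation of the greatest weight. -/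
def addRound : Program := block [.sub 12 12 10, .add 11 11 1]

/-- Take one edge of `H` into account for the required loads. -/
def targetRound : Program :=
  block [.sub 5 5 10, .load 13 5 5, .sub 13 13 10,
    .ite 13 (block [.load 14 6 5, .load 15 10 14, .add 15 15 11, .add 15 15 11, .store 10 14 15])
      .skip]

/-- Decrease the weight of the current edge. -/
def lowerWeight : Program :=
  block [.sub 27 27 10, .sub 28 28 10, .sub 30 30 10, .store 12 21 27, .store 12 22 28,
    .store 11 12 30, .const 16 1]

/-- Increase the weight of the current edge. -/
def raiseWeight : Program :=
  block [.add 27 27 10, .add 28 28 10, .add 30 30 10, .store 12 21 27, .store 12 22 28,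
    .store 11 12 30, .const 16 1]

/-- Balance the current edge, which lies in a fibre. -/
def balanceInner : Program :=
  -- Both ends lie in one fibre and share the target in register 29. With truncated subtraction,
  -- register 33 is nonzero exactly when the excesses sum to at least 2, and later, when they sum to
  -- at most `-2`; register 34 is nonzero when the weight is not yet maximal.
  block [.load 27 12 21, .load 28 12 22, .load 29 10 23, .load 30 11 12, .add 31 27 28,
    .add 32 29 29, .sub 33 31 32, .sub 33 33 10,
    .ite 33 (.ite 30 lowerWeight .skip)
      (block [.sub 33 32 31, .sub 33 33 10, .sub 34 11 30,
        .ite 33 (.ite 34 raiseWeight .skip) .skip])]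

/-- Load the ends of the current edge and their images. -/
def loadEnds : Program :=
  block [.load 21 2 12, .load 22 3 12, .load 23 8 21, .load 24 8 22, .sub 25 23 24,
    .sub 26 24 23, .add 25 25 26]

/-- Balance the current edge if it is an ordinary edge in a fibre. -/
def balanceEdge : Program :=
  block [.load 20 1 12, .ite 20 (block [loadEnds, .ite 25 .skip balanceInner]) .skip]

/-- Take one edge in a sweep over all edges. -/
def sweepRound : Program := .seq (.sub 12 12 10) balanceEdge

/-- Balance all edges, one after the other. -/
def sweep : Program := .seq (block [.const 16 0, .add 12 1 9]) (.loop 12 sweepRound)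

/-- Add the deviation of one vertex to register `17`. -/
def deviationRound : Program :=
  block [.sub 0 0 10, .load 18 12 0, .load 19 8 0, .load 19 10 19, .sub 20 18 19, .sub 21 19 18,
    .add 17 17 20, .add 17 17 21]

/-- The program that decides the extension problem. -/
def decider : Program :=
  block [setup, .loop 12 addRound, .loop 5 targetRound, .const 16 1, .loop 16 sweep,
    .loop 0 deviationRound, .sub 0 11 17]

/-! ### Correctness and running time of the program -/

variable {I : ExtensionInstance}

/-- The greatest weight. -/
def weight (I : ExtensionInstance) : ℕ := I.n * I.m + 1

/-- The input is still there, and the registers with constants hold their values. -/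
structure Ready (I : ExtensionInstance) (s : Store) : Prop where
  mem : ∀ b < 10, s.mem b = I.init.mem b
  reg_zero : s.reg 0 = I.n
  reg_one : s.reg 1 = I.m
  reg_nine : s.reg 9 = 0
  reg_ten : s.reg 10 = 1
  reg_sum : s.reg 17 = 0

/-- The greatest weight and the required loads have been computed. -/
structure Prepared (I : ExtensionInstance) (s : Store) : Prop extends Ready I s where
  reg_weight : s.reg 11 = I.weight
  target : ∀ u : Fin I.n', s.mem 10 u = 2 * (I.weight * I.H.numLoop u)

/-- The weights `y` and the loads of the vertices are in the store. -/
structure Holds (I : ExtensionInstance) (y : Fin I.m → ℕ) (s : Store) : Prop where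
  weights : ∀ e : Fin I.m, s.mem 11 e = y e
  loads : ∀ x : Fin I.n, s.mem 12 x = I.G.load I.fV y x
  le : ∀ e, y e ≤ I.weight

theorem Ready.eval {s : Store} (h : Ready I s) (p : Program)
    (hr : ∀ r ∈ [0, 1, 9, 10, 17], r ∉ p.regsWritten) (hb : ∀ b < 10, b ∉ p.banksWritten) :
    Ready I (p.eval s) where
  mem b hlt := by rw [Program.eval_mem_of_notMem (hb b hlt), h.mem b hlt]
  reg_zero := by rw [Program.eval_reg_of_notMem (hr 0 (by simp)), h.reg_zero]
  reg_one := by rw [Program.eval_reg_of_notMem (hr 1 (by simp)), h.reg_one]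
  reg_nine := by rw [Program.eval_reg_of_notMem (hr 9 (by simp)), h.reg_nine]
  reg_ten := by rw [Program.eval_reg_of_notMem (hr 10 (by simp)), h.reg_ten]
  reg_sum := by rw [Program.eval_reg_of_notMem (hr 17 (by simp)), h.reg_sum]

theorem Prepared.eval {s : Store} (h : Prepared I s) (p : Program)
    (hr : ∀ r ∈ [0, 1, 9, 10, 17, 11], r ∉ p.regsWritten) (hb : ∀ b < 11, b ∉ p.banksWritten) :
    Prepared I (p.eval s) where
  toReady := h.toReady.eval p (fun r hr' => hr r (by simp at hr' ⊢; tauto))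
    fun b hlt => hb b (by omega)
  reg_weight := by rw [Program.eval_reg_of_notMem (hr 11 (by simp)), h.reg_weight]
  target u := by rw [Program.eval_mem_of_notMem (hb 10 (by simp)), h.target]

theorem runs_setup : Runs setup I.init 10 fun s =>
    (Ready I s ∧ s.reg 5 = I.m' ∧ ∀ b, 10 ≤ b → s.mem b = fun _ => 0) ∧
      s.reg 11 = 1 ∧ s.reg 12 = I.n := by
  obtain ⟨h0, h1, h5, h9⟩ := I.init_reg
  refine (Runs.of_loopFree (by simp [setup, block, Program.LoopFree]) ?_).mono
    (by simp [setup, block, Program.cost]) fun _ h => h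
  refine ⟨⟨⟨?_, ?_, ?_, ?_, ?_, ?_⟩, ?_, ?_⟩, ?_, ?_⟩ <;>
    simp +contextual [setup, block, Program.eval, h0, h1, h5, h9]
  exact fun b hb => I.init_mem_of_le (by omega)

/-- The machine cannot multiply, so `n * m` is added up in `n` rounds; the invariant is that the
register plus the pending rounds gives the final value. -/
theorem runs_addRounds {s : Store}
    (h : (Ready I s ∧ s.reg 5 = I.m' ∧ ∀ b, 10 ≤ b → s.mem b = fun _ => 0) ∧
      s.reg 11 = 1 ∧ s.reg 12 = I.n) :
    Runs (.loop 12 addRound) s (I.n * 10 + 1) fun s =>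
      (Ready I s ∧ s.reg 5 = I.m' ∧ ∀ b, 10 ≤ b → s.mem b = fun _ => 0) ∧
        s.reg 11 = I.weight := by
  refine (Runs.countdown (B := 9) (J := fun k s =>
    (Ready I s ∧ s.reg 5 = I.m' ∧ ∀ b, 10 ≤ b → s.mem b = fun _ => 0) ∧
      s.reg 11 + k * I.m = I.weight) ?_ h.2.2 ⟨h.1, ?_⟩).mono le_rfl ?_
  · rintro k s ⟨⟨hs, h5, hm⟩, h11⟩ hk
    refine (Runs.of_loopFree (by simp [addRound, block, Program.LoopFree]) ?_).mono
      (by simp [addRound, block, Program.cost]) fun _ h => h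
    refine ⟨⟨⟨hs.eval _ (by decide) (by decide), ?_, ?_⟩, ?_⟩, ?_⟩
    · simpa [addRound, block, Program.eval] using h5
    · simpa [addRound, block, Program.eval] using hm
    · simp only [addRound, block, Program.eval, Store.setReg_reg, hs.reg_one]
      rw [Nat.add_mul] at h11
      simp
      omega
    · simp [addRound, block, Program.eval, hk, hs.reg_ten]
  · rw [h.2.1, weight, add_comm]
  · rintro s ⟨hs, h11⟩
    exact ⟨hs, by simpa using h11⟩

open scoped Classical in
theorem numLoop_eq_sum (u : Fin I.n') :
    I.H.numLoop u = ∑ d, if I.H.kind d = EdgeKind.loop ∧ u ∈ I.H.ends d then 1 else 0 := by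
  rw [numLoop, Set.ncard_eq_toFinset_card', Finset.sum_boole]
  simp

theorem runs_targetRounds {s : Store}
    (h : (Ready I s ∧ s.reg 5 = I.m' ∧ ∀ b, 10 ≤ b → s.mem b = fun _ => 0) ∧
      s.reg 11 = I.weight) :
    Runs (.loop 5 targetRound) s (I.m' * 20 + 1) fun s =>
      Prepared I s ∧ Holds I (fun _ => 0) s := by
  classical
  refine (Runs.countdown (B := 19) (J := fun k s =>
    (Ready I s ∧ s.reg 11 = I.weight ∧ s.mem 11 = (fun _ => 0) ∧ s.mem 12 = fun _ => 0) ∧ k ≤ I.m' ∧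
      ∀ u : Fin I.n', s.mem 10 u + 2 * (I.weight * ∑ d : Fin I.m', if (d : ℕ) < k then
        (if I.H.kind d = EdgeKind.loop ∧ u ∈ I.H.ends d then 1 else 0) else 0) =
        2 * (I.weight * I.H.numLoop u)) ?_ h.1.2.1 ⟨⟨h.1.1, h.2, ?_, ?_⟩, le_rfl, ?_⟩).mono
    le_rfl ?_
  · rintro k s ⟨⟨hs, h11, hm11, hm12⟩, hkm, ht⟩ hk
    refine (Runs.of_loopFree (by simp [targetRound, block, Program.LoopFree]) ?_).mono
      (by simp [targetRound, block, Program.cost]) fun _ h => h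
    refine ⟨⟨⟨hs.eval _ (by decide) (by decide), ?_, ?_, ?_⟩, by omega, ?_⟩, ?_⟩
    · rw [Program.eval_reg_of_notMem (by decide), h11]
    · rw [Program.eval_mem_of_notMem (by decide), hm11]
    · rw [Program.eval_mem_of_notMem (by decide), hm12]
    · intro u
      set d : Fin I.m' := ⟨k, hkm⟩ with hd
      have hdk : (d : ℕ) = k := rfl
      rw [← ht u, ← hdk, Fin.sum_ite_val_lt_succ]
      have h5 : s.mem 5 k = (I.H.kind d).code := by
        rw [hs.mem 5 (by norm_num)]; exact (I.init_mem_H d).1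
      have h6 : s.mem 6 k = ((I.H.ends d).inf : ℕ) := by
        rw [hs.mem 6 (by norm_num)]; exact (I.init_mem_H d).2
      have hev : (targetRound.eval s).mem 10 u = s.mem 10 u + if I.H.kind d = EdgeKind.loop ∧
          u = (I.H.ends d).inf then I.weight + I.weight else 0 := by
        cases hkd : I.H.kind d <;>
          simp [targetRound, block, Program.eval, hk, hs.reg_ten, h5, h6, h11, hkd,
            EdgeKind.code, Function.update_apply, Fin.ext_iff]
        split_ifs with h
        · rw [h, add_assoc]
        · rfl
      -- Both ends of a loop coincide, so reading the smaller one suffices.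
      have hmem : (I.H.kind d = EdgeKind.loop ∧ u ∈ I.H.ends d) ↔
          (I.H.kind d = EdgeKind.loop ∧ u = (I.H.ends d).inf) := by
        refine and_congr_right fun hkd => ?_
        have h1 := (kind_ne_ordinary_iff_exists (G := I.H) d).1 (by simp [hkd])
        obtain ⟨v, hv⟩ := h1
        simp [hv]
      rw [hev]
      simp only [hmem]
      split_ifs <;> ring
    · rw [targetRound, block, Program.eval, Program.eval_reg_of_notMem (by decide)]
      simp [Program.eval, hk, hs.reg_ten]
  · exact h.1.2.2 11 (by norm_num)
  · exact h.1.2.2 12 (by norm_num)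
  · intro u
    rw [h.1.2.2 10 le_rfl, numLoop_eq_sum]
    simp
  · rintro s ⟨⟨hs, h11, hm11, hm12⟩, -, ht⟩
    refine ⟨⟨hs, h11, fun u => by simpa using ht u⟩, ⟨fun e => by simp [hm11], fun x => ?_,
      fun e => Nat.zero_le _⟩⟩
    simp [hm12, SGraph.load]

/-- The effect of one step of a sweep on the weights. -/
theorem exists_holds_eval_balanceEdge (hG : I.G.IsBipartite) {s : Store} {y : Fin I.m → ℕ}
    {e : Fin I.m} (hs : Prepared I s) (hy : Holds I y s) (he : s.reg 12 = e) :
    ∃ y', Holds I y' (balanceEdge.eval s) ∧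
      ((y' = y ∧ (balanceEdge.eval s).reg 16 = s.reg 16 ∧
        (e ∈ I.G.innerEdges I.fV → IsBalanced I.G I.H I.fV I.weight y e)) ∨
      ((balanceEdge.eval s).reg 16 = 1 ∧
        I.G.energy I.H I.fV I.weight y' < I.G.energy I.H I.fV I.weight y)) := by
  classical
  obtain ⟨i1, i2, i3⟩ := I.init_mem_G e
  rw [← hs.mem 1 (by norm_num)] at i1
  rw [← hs.mem 2 (by norm_num)] at i2
  rw [← hs.mem 3 (by norm_num)] at i3
  have h8 : ∀ x : Fin I.n, s.mem 8 x = (I.fV x : ℕ) := fun x => by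
    rw [hs.mem 8 (by norm_num), I.init_mem_fV]
  have unchanged : (balanceEdge.eval s).mem 11 = s.mem 11 → (balanceEdge.eval s).mem 12 = s.mem 12 →
      Holds I y (balanceEdge.eval s) := fun h11 h12 =>
    ⟨fun e => by rw [h11, hy.weights], fun x => by rw [h12, hy.loads], hy.le⟩
  by_cases hk : I.G.kind e = EdgeKind.ordinary
  swap
  · have hk' : I.G.kind e = EdgeKind.semi := by
      have := hG.1 e
      cases hke : I.G.kind e <;> simp_all
    have h_eval : balanceEdge.eval s = s.setReg 20 0 := by
      simp [balanceEdge, block, Program.eval, he, i1, hk', EdgeKind.code]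
    refine ⟨y, unchanged (by simp [h_eval]) (by simp [h_eval]), Or.inl ⟨rfl, by simp [h_eval], ?_⟩⟩
    intro hin
    exact absurd (mem_innerEdges.1 hin).1 hk
  set a := (I.G.ends e).inf with ha
  set b := (I.G.ends e).sup with hb
  have hab : I.G.ends e = s(a, b) := (Sym2.mk_inf_sup _).symm
  have hne : a ≠ b := by
    intro h
    refine (I.G.isDiag_iff e).1 ?_ hk
    rw [hab, h]
    exact Sym2.mk_isDiag_iff.2 rfl
  have inner_iff : e ∈ I.G.innerEdges I.fV ↔ I.fV a = I.fV b := by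
    rw [mem_innerEdges, hab, Sym2.map_mk, Sym2.mk_isDiag_iff]
    exact and_iff_right hk
  set s₁ := loadEnds.eval (s.setReg 20 1) with hs₁
  have h_eval : balanceEdge.eval s = if s₁.reg 25 ≠ 0 then s₁ else balanceInner.eval s₁ := by
    simp [balanceEdge, block, Program.eval, he, i1, hk, EdgeKind.code, hs₁]
  have s₁_mem : s₁.mem = s.mem := by
    simp [hs₁, loadEnds, block, Program.eval]
  have r25 : s₁.reg 25 = ((I.fV a : ℕ) - I.fV b) + (I.fV b - I.fV a) := by
    simp [hs₁, loadEnds, block, Program.eval, he, i2, i3, h8]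
  have r21 : s₁.reg 21 = a := by simp [hs₁, loadEnds, block, Program.eval, he, i2]
  have r22 : s₁.reg 22 = b := by simp [hs₁, loadEnds, block, Program.eval, he, i3]
  have r23 : s₁.reg 23 = I.fV a := by simp [hs₁, loadEnds, block, Program.eval, he, i2, h8]
  have r12 : s₁.reg 12 = e := by simp [hs₁, loadEnds, block, Program.eval, he]
  have r10 : s₁.reg 10 = 1 := by simp [hs₁, loadEnds, block, Program.eval, hs.reg_ten]
  have r11 : s₁.reg 11 = I.weight := by simp [hs₁, loadEnds, block, Program.eval, hs.reg_weight]
  have r16 : s₁.reg 16 = s.reg 16 := by simp [hs₁, loadEnds, block, Program.eval]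
  by_cases hin : I.fV a = I.fV b
  swap
  · have h25 : s₁.reg 25 ≠ 0 := by
      rw [r25]
      have := Fin.val_ne_of_ne hin
      omega
    rw [if_pos h25] at h_eval
    refine ⟨y, unchanged (by rw [h_eval, s₁_mem]) (by rw [h_eval, s₁_mem]),
      Or.inl ⟨rfl, by rw [h_eval, r16], ?_⟩⟩
    intro h
    exact absurd (inner_iff.1 h) hin
  have h25 : ¬ s₁.reg 25 ≠ 0 := by
    rw [r25, hin]
    simp
  rw [if_neg h25] at h_eval
  set la := I.G.load I.fV y a with hla
  set lb := I.G.load I.fV y b with hlb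
  set t := 2 * (I.weight * I.H.numLoop (I.fV a)) with ht
  have m12a : s₁.mem 12 a = la := by rw [s₁_mem, hy.loads]
  have m12b : s₁.mem 12 b = lb := by rw [s₁_mem, hy.loads]
  have m10 : s₁.mem 10 (I.fV a) = t := by rw [s₁_mem, hs.target]
  have m11 : s₁.mem 11 e = y e := by rw [s₁_mem, hy.weights]
  have ex_sum : I.G.excess I.H I.fV I.weight y a + I.G.excess I.H I.fV I.weight y b =
      (la + lb : ℕ) - (t + t : ℕ) := by
    simp only [excess, ← hin, hla, hlb, ht]
    push_cast
    ring
  -- The new load is written as `la + v - y e`; this natural-number subtraction is exact because the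
  -- load at an end includes `y e`.
  have changed : ∀ v, v ≤ I.weight →
      (balanceEdge.eval s).mem 11 = Function.update (s.mem 11) e v →
      (balanceEdge.eval s).mem 12 =
        Function.update (Function.update (s.mem 12) a (la + v - y e)) b (lb + v - y e) →
      y e ≤ la → y e ≤ lb → Holds I (Function.update y e v) (balanceEdge.eval s) := by
    intro v hv h11 h12 hla' hlb'
    refine ⟨fun e' => ?_, fun x => ?_, fun e' => ?_⟩
    · rw [h11]
      by_cases h : e' = e
      · simp [h]
      · rw [Function.update_of_ne (Fin.val_ne_of_ne h), Function.update_of_ne h, hy.weights]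
    · have h := load_update (inner_iff.2 hin) y v x
      rw [h12]
      by_cases hxb : x = b
      · subst hxb
        rw [if_pos (by simp [hab]), if_pos (by simp [hab])] at h
        rw [Function.update_self]
        omega
      by_cases hxa : x = a
      · subst hxa
        rw [if_pos (by simp [hab]), if_pos (by simp [hab])] at h
        rw [Function.update_of_ne (Fin.val_ne_of_ne hne), Function.update_self]
        omega
      · rw [if_neg (by simp [hab, hxa, hxb]), if_neg (by simp [hab, hxa, hxb])] at h
        rw [Function.update_of_ne (Fin.val_ne_of_ne hxb), Function.update_of_ne
          (Fin.val_ne_of_ne hxa), hy.loads]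
        omega
    · by_cases h : e' = e
      · subst h; simpa using hv
      · rw [Function.update_of_ne h]; exact hy.le e'
  have le_load : ∀ x ∈ I.G.ends e, y e ≤ I.G.load I.fV y x := fun x hx =>
    Finset.single_le_sum (f := y) (fun _ _ => Nat.zero_le _)
      (by simp [inner_iff.2 hin, hx])
  have hya : y e ≤ la := le_load a (by simp [hab])
  have hyb : y e ≤ lb := le_load b (by simp [hab])
  have balanced_of : (0 < y e → la + lb ≤ t + t + 1) →
      (y e < I.weight → t + t ≤ la + lb + 1) →
      IsBalanced I.G I.H I.fV I.weight y e := by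
    intro h1 h2 a' b' hab'
    have h3 : I.G.excess I.H I.fV I.weight y a' + I.G.excess I.H I.fV I.weight y b' =
        I.G.excess I.H I.fV I.weight y a + I.G.excess I.H I.fV I.weight y b := by
      rw [hab, Sym2.eq_iff] at hab'
      rcases hab' with ⟨rfl, rfl⟩ | ⟨rfl, rfl⟩
      · rfl
      · exact add_comm _ _
    rw [h3, ex_sum]
    exact ⟨fun h => by have := h1 h; omega, fun h => by have := h2 h; omega⟩
  have hle := hy.le e
  by_cases hhigh : la + lb - (t + t) - 1 = 0
  · by_cases hlow : t + t - (la + lb) - 1 = 0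
    · have e11 : (balanceEdge.eval s).mem = s.mem := by
        simp [h_eval, balanceInner, block, Program.eval, r21, r22, r23, r12, r10, r11, m12a, m12b,
          m10, m11, hhigh, hlow, s₁_mem]
      have e16 : (balanceEdge.eval s).reg 16 = s.reg 16 := by
        simp [h_eval, balanceInner, block, Program.eval, r21, r22, r23, r12, r10, r11, m12a, m12b,
          m10, m11, hhigh, hlow, r16]
      refine ⟨y, unchanged (by rw [e11]) (by rw [e11]), Or.inl ⟨rfl, e16, fun _ => balanced_of ?_ ?_⟩⟩ <;>
        intro <;> omega
    · by_cases hfull : I.weight - y e = 0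
      · have e11 : (balanceEdge.eval s).mem = s.mem := by
          simp [h_eval, balanceInner, block, Program.eval, r21, r22, r23, r12, r10, r11, m12a, m12b,
            m10, m11, hhigh, hlow, hfull, s₁_mem]
        have e16 : (balanceEdge.eval s).reg 16 = s.reg 16 := by
          simp [h_eval, balanceInner, block, Program.eval, r21, r22, r23, r12, r10, r11, m12a, m12b,
            m10, m11, hhigh, hlow, hfull, r16]
        refine ⟨y, unchanged (by rw [e11]) (by rw [e11]), Or.inl ⟨rfl, e16, fun _ => balanced_of ?_ ?_⟩⟩ <;>
          intro <;> omega
      · refine ⟨Function.update y e (y e + 1), changed _ (by omega) ?_ ?_ hya hyb, Or.inr ⟨?_, ?_⟩⟩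
        · simp [h_eval, balanceInner, raiseWeight, block, Program.eval, r21, r22, r23, r12, r10, r11,
            m12a, m12b, m10, m11, hhigh, hlow, hfull, s₁_mem]
        · rw [show la + (y e + 1) - y e = la + 1 by omega, show lb + (y e + 1) - y e = lb + 1 by omega]
          simp [h_eval, balanceInner, raiseWeight, block, Program.eval, r21, r22, r23, r12, r10, r11,
            m12a, m12b, m10, m11, hhigh, hlow, hfull, s₁_mem]
        · simp [h_eval, balanceInner, raiseWeight, block, Program.eval, r21, r22, r23, r12, r10, r11,
            m12a, m12b, m10, m11, hhigh, hlow, hfull]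
        · exact energy_update_lt (inner_iff.2 hin) hab hne (Or.inl ⟨rfl, by rw [ex_sum]; omega⟩)
  · by_cases hzero : y e = 0
    · have e11 : (balanceEdge.eval s).mem = s.mem := by
        simp [h_eval, balanceInner, block, Program.eval, r21, r22, r23, r12, r10, m12a, m12b,
          m10, m11, hhigh, hzero, s₁_mem]
      have e16 : (balanceEdge.eval s).reg 16 = s.reg 16 := by
        simp [h_eval, balanceInner, block, Program.eval, r21, r22, r23, r12, r10, m12a, m12b,
          m10, m11, hhigh, hzero, r16]
      refine ⟨y, unchanged (by rw [e11]) (by rw [e11]), Or.inl ⟨rfl, e16, fun _ => balanced_of ?_ ?_⟩⟩ <;>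
        intro <;> omega
    · refine ⟨Function.update y e (y e - 1), changed _ (by omega) ?_ ?_ hya hyb, Or.inr ⟨?_, ?_⟩⟩
      · simp [h_eval, balanceInner, lowerWeight, block, Program.eval, r21, r22, r23, r12, r10,
          m12a, m12b, m10, m11, hhigh, hzero, s₁_mem]
      · rw [show la + (y e - 1) - y e = la - 1 by omega, show lb + (y e - 1) - y e = lb - 1 by omega]
        simp [h_eval, balanceInner, lowerWeight, block, Program.eval, r21, r22, r23, r12, r10,
          m12a, m12b, m10, m11, hhigh, hzero, s₁_mem]
      · simp [h_eval, balanceInner, lowerWeight, block, Program.eval, r21, r22, r23, r12, r10,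
          m12a, m12b, m10, m11, hhigh, hzero]
      · exact energy_update_lt (inner_iff.2 hin) hab hne
          (Or.inr ⟨by omega, by rw [ex_sum]; omega⟩)

theorem runs_sweep (hG : I.G.IsBipartite) {s : Store} {y : Fin I.m → ℕ} (hs : Prepared I s)
    (hy : Holds I y s) :
    Runs sweep s (I.m * 71 + 3) fun s' => Prepared I s' ∧ ∃ y', Holds I y' s' ∧
      I.G.energy I.H I.fV I.weight y' ≤ I.G.energy I.H I.fV I.weight y ∧
      (s'.reg 16 = 0 → ∀ e ∈ I.G.innerEdges I.fV, IsBalanced I.G I.H I.fV I.weight y' e) ∧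
      (s'.reg 16 ≠ 0 →
        I.G.energy I.H I.fV I.weight y' < I.G.energy I.H I.fV I.weight y) := by
  refine (Runs.seq (B₁ := 2) (B₂ := I.m * 71 + 1) (R := fun s' => (Prepared I s' ∧ Holds I y s' ∧
    s'.reg 16 = 0) ∧ s'.reg 12 = I.m) ((Runs.of_loopFree (by simp [block, Program.LoopFree])
      ?_).mono (by simp [block, Program.cost]) fun _ h => h) ?_).mono (by omega) fun _ h => h
  · refine ⟨⟨hs.eval _ (by decide) (by decide), ⟨fun e => ?_, fun x => ?_, hy.le⟩, ?_⟩, ?_⟩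
    · rw [Program.eval_mem_of_notMem (by decide), hy.weights]
    · rw [Program.eval_mem_of_notMem (by decide), hy.loads]
    · simp [block, Program.eval]
    · simp [block, Program.eval, hs.reg_one, hs.reg_nine]
  · rintro s₁ ⟨⟨hs₁, hy₁, h16⟩, h12⟩
    -- Flag 0 means that no weight has changed in this sweep, so edges visited earlier are still
    -- balanced for the current weights. Once the flag is set, only the strict drop in energy is
    -- claimed.
    refine (Runs.countdown (B := 70) (J := fun k s' => k ≤ I.m ∧ Prepared I s' ∧
      ∃ y', Holds I y' s' ∧
      I.G.energy I.H I.fV I.weight y' ≤ I.G.energy I.H I.fV I.weight y ∧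
      (s'.reg 16 = 0 → ∀ e : Fin I.m, k ≤ e → e ∈ I.G.innerEdges I.fV →
        IsBalanced I.G I.H I.fV I.weight y' e) ∧
      (s'.reg 16 ≠ 0 →
        I.G.energy I.H I.fV I.weight y' < I.G.energy I.H I.fV I.weight y)) ?_ h12
      ⟨le_rfl, hs₁, y, hy₁, le_rfl, fun _ e he => absurd e.2 (by omega),
        fun h => absurd h16 h⟩).mono le_rfl ?_
    · rintro k s ⟨hkm, hs, y', hy', hle, hzero, hpos⟩ hk
      refine (Runs.of_loopFree (by simp [sweepRound, balanceEdge, loadEnds, balanceInner,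
        lowerWeight, raiseWeight, block, Program.LoopFree]) ?_).mono (by decide) fun _ h => h
      have h12' : (Program.eval (.sub 12 12 10) s).reg 12 = (⟨k, hkm⟩ : Fin I.m) := by
        simp [Program.eval, hk, hs.reg_ten]
      have h16' : (Program.eval (.sub 12 12 10) s).reg 16 = s.reg 16 := by
        simp [Program.eval]
      have hsub : Prepared I (Program.eval (.sub 12 12 10) s) := hs.eval _ (by decide) (by decide)
      have hyub : Holds I y' (Program.eval (.sub 12 12 10) s) := ⟨hy'.weights, hy'.loads, hy'.le⟩
      obtain ⟨y'', hy'', h⟩ := exists_holds_eval_balanceEdge hG hsub hyub h12'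
      refine ⟨⟨by omega, hsub.eval _ (by decide) (by decide), y'', hy'', ?_⟩, ?_⟩
      · rw [sweepRound, Program.eval]
        rcases h with ⟨rfl, h16'', hbal⟩ | ⟨h16'', hlt⟩
        · rw [h16'', h16']
          refine ⟨hle, fun h0 e hke he => ?_, hpos⟩
          rcases hke.eq_or_lt with h | h
          · obtain rfl : e = ⟨k, hkm⟩ := Fin.ext h.symm
            exact hbal he
          · exact hzero h0 e h he
        · rw [h16'']
          exact ⟨hlt.le.trans hle, fun h => absurd h one_ne_zero, fun _ => hlt.trans_le hle⟩
      · rw [sweepRound, Program.eval, Program.eval_reg_of_notMem (by decide), h12']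
    · rintro s' ⟨-, hs', y', hy', hle, hzero, hpos⟩
      exact ⟨hs', y', hy', hle, fun h e he => hzero h e (Nat.zero_le _) he, hpos⟩

theorem runs_sweeps (hG : I.G.IsBipartite) {s : Store} {y : Fin I.m → ℕ} (hs : Prepared I s)
    (hy : Holds I y s) (h16 : s.reg 16 = 1) :
    Runs (.loop 16 sweep) s ((I.G.energy I.H I.fV I.weight y + 1) * (I.m * 71 + 4) + 1) fun s' =>
      Prepared I s' ∧ ∃ y', Holds I y' s' ∧
        ∀ e ∈ I.G.innerEdges I.fV, IsBalanced I.G I.H I.fV I.weight y' e := by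
  -- The counter bounds the energy only while the flag is set, so the last sweep, which changes
  -- nothing, needs no decrease. The start value is the energy plus 1 because the bound is strict.
  refine (Runs.loop (B := I.m * 71 + 3) (J := fun k s' => Prepared I s' ∧ ∃ y', Holds I y' s' ∧
    (s'.reg 16 = 0 → ∀ e ∈ I.G.innerEdges I.fV, IsBalanced I.G I.H I.fV I.weight y' e) ∧
    (s'.reg 16 ≠ 0 → I.G.energy I.H I.fV I.weight y' < k)) ?_
    (k := I.G.energy I.H I.fV I.weight y + 1) (s := s) ?_).mono le_rfl ?_
  · rintro k s ⟨hs, y, hy, -, hlt⟩ h16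
    refine (runs_sweep hG hs hy).mono le_rfl ?_
    rintro s' ⟨hs', y', hy', -, hzero, hpos⟩
    exact ⟨_, hlt h16, hs', y', hy', hzero, hpos⟩
  · exact ⟨hs, y, hy, fun h => absurd h (by simp [h16]), fun _ => Nat.lt_succ_self _⟩
  · rintro s' ⟨h16, k, hs', y', hy', hzero, -⟩
    exact ⟨hs', y', hy', hzero h16⟩

theorem runs_deviationRounds {s : Store} {y : Fin I.m → ℕ} (hs : Prepared I s)
    (hy : Holds I y s) :
    Runs (.loop 0 deviationRound) s (I.n * 10 + 1) fun s' =>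
      s'.reg 11 = I.weight ∧
        s'.reg 17 = ∑ x, (I.G.excess I.H I.fV I.weight y x).natAbs := by
  refine (Runs.countdown (B := 9) (J := fun k s' => k ≤ I.n ∧ s'.mem = s.mem ∧ s'.reg 10 = 1 ∧
    s'.reg 11 = I.weight ∧ s'.reg 17 + ∑ x : Fin I.n, (if (x : ℕ) < k then
      (I.G.excess I.H I.fV I.weight y x).natAbs else 0) =
        ∑ x, (I.G.excess I.H I.fV I.weight y x).natAbs) ?_ hs.reg_zero
    ⟨le_rfl, rfl, hs.reg_ten, hs.reg_weight, by simp [hs.reg_sum]⟩).mono le_rfl ?_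
  · rintro k s' ⟨hkn, hm, h10, h11, h17⟩ hk
    refine (Runs.of_loopFree (by simp [deviationRound, block, Program.LoopFree]) ?_).mono
      (by decide) fun _ h => h
    refine ⟨⟨by omega, ?_, ?_, ?_, ?_⟩, ?_⟩
    · simp [deviationRound, block, Program.eval, hm]
    · simp [deviationRound, block, Program.eval, h10]
    · simp [deviationRound, block, Program.eval, h11]
    · set x : Fin I.n := ⟨k, hkn⟩ with hx
      have hxk : (x : ℕ) = k := rfl
      rw [← hxk, Fin.sum_ite_val_lt_succ, hxk] at h17
      have h8 : s.mem 8 k = (I.fV x : ℕ) := by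
        rw [hs.mem 8 (by norm_num), ← hxk, I.init_mem_fV]
      have h12 : s.mem 12 k = I.G.load I.fV y x := hy.loads x
      -- The absolute value is the sum of the two truncated differences, one of which vanishes.
      have h17' : (deviationRound.eval s').reg 17 =
          s'.reg 17 + (I.G.excess I.H I.fV I.weight y x).natAbs := by
        simp [deviationRound, block, Program.eval, hk, h10, hm, h8, h12, hs.target, excess]
        omega
      rw [h17']
      omega
    · simp [deviationRound, block, Program.eval, hk, h10]
  · rintro s' ⟨-, -, -, h11, h17⟩
    exact ⟨h11, by simpa using h17⟩

theorem runs_decider (hG : I.G.IsBipartite) (hf : IsDegreeObedient I.G I.H I.fV) :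
    Runs decider I.init (10 + ((I.n * 10 + 1) + ((I.m' * 20 + 1) + (1 +
      (((I.n * (2 * (I.weight * I.m')) ^ 2 + 1) * (I.m * 71 + 4) + 1) +
      ((I.n * 10 + 1) + 1)))))) fun s =>
        (s.reg 0 ≠ 0 ↔ ExtendsToCovering I.G I.H I.fV) := by
  refine runs_setup.seq fun s hs => (runs_addRounds hs).seq fun s hs =>
    (runs_targetRounds hs).seq fun s hs => ?_
  refine Runs.seq (B₁ := 1) (R := fun s => (Prepared I s ∧ Holds I (fun _ => 0) s) ∧ s.reg 16 = 1)
    ⟨_, 1, .const s 16 1, le_rfl, ⟨hs.1.eval (.const 16 1) (by decide) (by decide),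
      hs.2.weights, hs.2.loads, hs.2.le⟩, by simp⟩ fun s hs => ?_
  have he : I.G.energy I.H I.fV I.weight (fun _ => 0) ≤ I.n * (2 * (I.weight * I.m')) ^ 2 := by
    simpa using energy_zero_le (G := I.G) (H := I.H) (fV := I.fV) I.weight
  refine ((runs_sweeps hG hs.1.1 hs.1.2 hs.2).mono (by gcongr) fun _ h => h).seq ?_
  rintro s ⟨hs, y, hy, hbal⟩
  refine (runs_deviationRounds hs hy).seq ?_
  rintro s ⟨h11, h17⟩
  refine ⟨_, 1, .sub s 0 11 17, le_rfl, ?_⟩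
  -- The truncated difference of the greatest weight and the total deviation is nonzero exactly when
  -- the deviation is smaller.
  have h0 : (s.setReg 0 (s.reg 11 - s.reg 17)).reg 0 ≠ 0 ↔
      ∑ x, (I.G.excess I.H I.fV I.weight y x).natAbs < I.weight := by
    rw [Store.setReg_reg, if_pos rfl, h11, h17, Nat.sub_ne_zero_iff_lt]
  refine h0.trans ⟨fun h => (hasLoopFactor_of_sum_excess_lt hG hf hy.le h).extendsToCovering hG hf,
    fun h => (h.hasLoopFactor hG).sum_excess_lt ?_ hy.le hbal⟩
  simp [weight]

end ExtensionInstance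

/-! ### The theorem -/

open Polynomial in
theorem theorem2p4 :
    RAM.DecidableInPolyTime ExtensionInstance.encode
      (fun I => I.G.IsBipartite ∧ SGraph.IsDegreeObedient I.G I.H I.fV)
      (fun I => SGraph.ExtendsToCovering I.G I.H I.fV) ∧
    ∀ (V E W F : Type*) [Finite V] [Finite E] [Finite W] [Finite F]
      (G : SGraph V E) (H : SGraph W F), G.IsBipartite → G.NoSemiEdges →
      ∀ fV : V → W, SGraph.IsDegreeObedient G H fV → SGraph.ExtendsToCovering G H fV := by
  -- The polynomial is the time bound of `runs_decider` with `X` in place of `n`, `m` and `m'`, each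
  -- of which is at most the input size.
  refine ⟨⟨ExtensionInstance.decider, 10 + ((X * 10 + 1) + ((X * 20 + 1) + (1 +
      (((X * (2 * ((X * X + 1) * X)) ^ 2 + 1) * (X * 71 + 4) + 1) + ((X * 10 + 1) + 1))))), ?_⟩,
    fun V E W F _ _ _ _ G H hG h fV hf => hG.extendsToCovering_of_noSemiEdges h hf⟩
  rintro I ⟨hG, hf⟩
  obtain ⟨s, t, he, ht, hs⟩ := ExtensionInstance.runs_decider hG hf
  refine ⟨s, t, he, ht.trans ?_, hs⟩
  obtain ⟨hn, hm, hm'⟩ := I.le_inputSize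
  simp only [eval_add, eval_mul, eval_pow, eval_X, eval_one, eval_ofNat, ExtensionInstance.weight]
  gcongr
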